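/- Let $A$ be an artin algebra which is local, with Jacobson radical $J$, and assume that $A$ is short, i.e. $J^3=0$. Write $|M|$ for the length of a module $M$, put $e=|J/J^2|$ and $a=|J^2|$, so that $(e,a)$ is the Hilbert type of $A$. Modules are finitely generated left $A$-modules unless stated otherwise, and right modules are treated in the same way. For a module $M$ let $M^*=\operatorname{Hom}_A(M,A)$ (a right module), and let $\phi_M\colon M\to M^{**}$ be the canonical evaluation map. A module $M$ is semi-Gorenstein-projective if $\operatorname{Ext}^i(M,A)=0$ for all $i\ge 1$. It is Gorenstein-projective if it is isomorphic to the image of a differential of an acyclic complex $P_\bullet$ of finitely generated projective modules indexed by $\mathbb Z$ whose $A$-dual $P_\bullet^*$ is acyclic. A complex $(Q_i,\,d_i\colon Q_i\to Q_{i-1})_{i\in\mathbb Z}$ is minimal if $\operatorname{Im} d_i\subseteq \operatorname{rad} Q_{i-1}$ for all $i$. If $J^2M=0$, the dimension vector of $M$ is $(|M/JM|,\,|JM|)$. (a) Assume that $A$ is not self-injective. Let $Q_\bullet=(Q_i,\,d_i\colon Q_i\to Q_{i-1})_{i\in\mathbb Z}$ be an acyclic minimal complex of finitely generated projective modules, let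 $N_i=\operatorname{Im} d_i$, and assume that at least one of the modules $N_i$ is semi-Gorenstein-projective. Then there is an integer $t\ge 0$ such that every $Q_i$ is free of rank $t$, and for every $j\in\mathbb Z$ we have $J^2N_j=0$ and the dimension vector of $N_j$ is $(t,at)$. (b) Let $M$ be a module such that both $M$ and the right module $M^*$ are semi-Gorenstein-projective. Then $|\operatorname{Ker}\phi_M|=|\operatorname{Cok}\phi_M|$. Hence, if $\phi_M$ is a monomorphism or an epimorphism, then $\phi_M$ is an isomorphism and $M$ is Gorenstein-projective. -/

import Mathlib

open CategoryTheory

universe v u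

namespace ShortLocal

section Radical

variable (A : Type u) [Ring A]

/-- A ring with Jacobson radical `J` is short if `J ^ 3 = 0` (used for local rings). -/
def IsShort : Prop := Ring.jacobson A ^ 3 = ⊥

/-- `A` is of Hilbert type `(e, a)`: the composition lengths of the left `A`-modules `J / J ^ 2`
and `J ^ 2` are `e` and `a`, where `J` is the Jacobson radical. -/
def HasHilbertType (e a : ℕ) : Prop :=
  Module.length A
      (↥(Ring.jacobson A) ⧸ (Ring.jacobson A ^ 2).submoduleOf (Ring.jacobson A)) = e ∧
    Module.length A ↥(Ring.jacobson A ^ 2) = a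

/-- `M` has Loewy length at most `2` and dimension vector `(t, s)`, i.e. `J ^ 2 M = 0`,
`|M / J M| = t` and `|J M| = s`. -/
def HasDimVector (M : Type u) [AddCommGroup M] [Module A M] (t s : ℕ) : Prop :=
  Ring.jacobson A ^ 2 • (⊤ : Submodule A M) = ⊥ ∧
    Module.length A (M ⧸ (Ring.jacobson A • (⊤ : Submodule A M))) = t ∧
    Module.length A ↥(Ring.jacobson A • (⊤ : Submodule A M)) = s

end Radical

section Dual

variable (A : Type u) [Ring A] (M : Type u) [AddCommGroup M] [Module A M]

/-- The `A`-dual `M^* = Hom_A(M, A)` of a left module. Right multiplication on `A` makes it a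
right `A`-module, i.e. a left module over `Aᵐᵒᵖ`. -/
abbrev ADual : Type u := M →ₗ[A] A

/-- The bidual `M^{**}`, the homomorphisms of right modules from `M^*` to `A`. Left multiplication
on `A` makes it a left `A`-module. -/
abbrev ABidual : Type u := ADual A M →ₗ[Aᵐᵒᵖ] A

/-- The canonical map `φ_M : M → M^{**}`, sending `m` to evaluation at `m`. -/
def phi : M →ₗ[A] ABidual A M where
  toFun m :=
    { toFun := fun f => f m
      map_add' := fun _ _ => rfl
      map_smul' := fun _ _ => rfl }
  map_add' m n := by
    ext f
    exact map_add f m n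
  map_smul' r m := by
    ext f
    exact map_smul f r m

/-- `M` is semi-Gorenstein-projective: `Ext^i_A(M, A) = 0` for all `i ≥ 1`.
Right `A`-modules are covered by taking `Aᵐᵒᵖ` for `A`. -/
def IsSemiGorensteinProjective : Prop :=
  ∀ i : ℕ, 1 ≤ i → Subsingleton (Abelian.Ext (ModuleCat.of A M) (ModuleCat.of A A) i)

end Dual

section Complexes

variable {A : Type u} [Ring A]

/-- All terms of the complex are finitely generated projective modules. -/
def IsProjectiveComplex (Q : ChainComplex (ModuleCat.{u} A) ℤ) : Prop :=
  ∀ i : ℤ, Module.Finite A (Q.X i) ∧ Module.Projective A (Q.X i)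

/-- The complex is minimal: the image of `d_i : Q_i → Q_{i-1}` is contained in the radical
(the intersection of the maximal submodules) of `Q_{i-1}`. -/
def IsMinimalComplex (Q : ChainComplex (ModuleCat.{u} A) ℤ) : Prop :=
  ∀ i : ℤ, LinearMap.range (Q.d i (i - 1)).hom ≤ Module.jacobson A (Q.X (i - 1))

/-- The image `N_i` of `d_i : Q_i → Q_{i-1}`. -/
abbrev imageAt (Q : ChainComplex (ModuleCat.{u} A) ℤ) (i : ℤ) : Submodule A (Q.X (i - 1)) :=
  LinearMap.range (Q.d i (i - 1)).hom

/-- The `A`-dual complex `Hom_A(Q, A)` is acyclic, i.e. exact at each `Hom_A(Q_i, A)`. -/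
def IsDualAcyclic (Q : ChainComplex (ModuleCat.{u} A) ℤ) : Prop :=
  ∀ i : ℤ, Function.Exact
    (fun h : Q.X (i - 1) →ₗ[A] A => h ∘ₗ (Q.d i (i - 1)).hom)
    (fun g : Q.X i →ₗ[A] A => g ∘ₗ (Q.d (i + 1) i).hom)

variable (A) in
/-- `M` is Gorenstein-projective: it is an image in a complete projective resolution, i.e. in an
acyclic complex of finitely generated projectives whose `A`-dual is acyclic too. -/
def IsGorensteinProjective (M : Type u) [AddCommGroup M] [Module A M] : Prop :=
  ∃ P : ChainComplex (ModuleCat.{u} A) ℤ,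
    IsProjectiveComplex P ∧ P.Acyclic ∧ IsDualAcyclic P ∧ Nonempty (M ≃ₗ[A] imageAt P 0)

end Complexes

end ShortLocal

/-!
Write `|X|` for the length of a module and `X^* = Hom(X, A)`. Lengths of duals are measured over the
base ring `k`, in units of the length of the simple module `A / J` (`resLen`, which is the same on
both sides by `resLen_op`), so that left and right modules can be compared.

*Socles.* Since `A / J` embeds into `A`, the module `A / J` cannot have eventually vanishing `Ext`
into `A` unless `A` is self-injective (`injective_of_extVanishes_residue`). Hence, if `A` is not
self-injective, a module with eventually vanishing `Ext` into `A` has no simple direct summand: its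
socle lies in its radical (`mem_jacobson_smul_of_extVanishes`).

*Two recursions.* Let `0 → K → F → N → 0` be exact with `F` free of rank `t`, `K ⊆ J F` and
`J ^ 2 N = 0`. Then `J ^ 2 F ⊆ K`, and if `K` has no simple summand, then `J K = J ^ 2 F`, so
`|J K| = a t` (`IsMinimalCover.radLen_left`). Along a minimal complex with ranks `tᵢ` this gives
`t₂ + a t₀ = e t₁` (`rank_recursion`). If `Ext^1(N, A) = 0` and `a ≥ 2`, the maps `K → A` with image
in `J ^ 2` are exactly the restrictions of the maps `F → J` (`IsMinimalCover.range_le_jacobson`),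
whence `|K^*| = a |K / J K| + t` (`IsMinimalCover.len_hom_left`). The exact sequence
`0 → N^* → F^* → K^* → 0` turns this into the dual recursion `a t₂ + t₀ = e t₁`. Together, the two
recursions make the ranks constant (`ranks_eq`). For `a ≤ 1` the module `N` vanishes, unless `A` is
self-injective. The first recursion alone then propagates the constant rank to the whole complex
(`exists_rank_of_minimal_complex`).

*The bidual.* If `A` is self-injective, then so is `Aᵐᵒᵖ`, and both dualities preserve length
(`len_bidual_of_injective`). Otherwise free summands of `M` are split off. If none is left, the dual
of the minimal cover of `M` is a minimal cover of right modules, and `ranks_eq`, applied to the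
first syzygy of `M` and to `M^*`, determines all lengths and gives `|M^{**}| = |M|` (`len_bidual`). So the
kernel and the cokernel of `M → M^{**}` have the same length.

*Gorenstein-projectivity.* If `M` is reflexive, a free resolution of `M` and the dual of a free
resolution of `M^*` are glued along `M ≅ M^{**}` (`isGorensteinProjective_of_bijective`).
-/

namespace ShortLocal

/-! ### Factoring through a surjection -/

section Factor

variable {A : Type*} [Ring A] {X Y Z W : Type*} [AddCommGroup X] [Module A X] [AddCommGroup Y]
  [Module A Y] [AddCommGroup Z] [Module A Z] [AddCommGroup W] [Module A W]

/-- A linear map which vanishes on the kernel of a surjection factors through it. -/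
theorem exists_factor {f : X →ₗ[A] Y} {g : Y →ₗ[A] Z} (hg : Function.Surjective g)
    (hfg : Function.Exact f g) (φ : Y →ₗ[A] W)
    (h : φ ∘ₗ f = 0) : ∃ ψ : Z →ₗ[A] W, ψ ∘ₗ g = φ := by
  have hle : LinearMap.ker g ≤ LinearMap.ker φ := by
    rw [hfg.linearMap_ker_eq]
    rintro _ ⟨x, rfl⟩
    exact LinearMap.congr_fun h x
  refine ⟨(LinearMap.ker g).liftQ φ hle ∘ₗ (g.quotKerEquivOfSurjective hg).symm.toLinearMap,
    LinearMap.ext fun y => ?_⟩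
  have : (g.quotKerEquivOfSurjective hg).symm (g y) = Submodule.Quotient.mk y := by
    rw [LinearEquiv.symm_apply_eq]; rfl
  change (LinearMap.ker g).liftQ φ hle ((g.quotKerEquivOfSurjective hg).symm (g y)) = φ y
  rw [this]
  rfl

end Factor

/-! ### Vanishing of `Ext` into the ring -/

section Ext

variable (B : Type u) [Ring B]

/-- `Ext^n_B(X, B) = 0`. -/
def ExtVanishes (X : Type u) [AddCommGroup X] [Module B X] (n : ℕ) : Prop :=
  Subsingleton (Abelian.Ext (ModuleCat.of B X) (ModuleCat.of B B) n)

variable {B}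
variable {X Y Z : Type u} [AddCommGroup X] [Module B X] [AddCommGroup Y] [Module B Y]
  [AddCommGroup Z] [Module B Z]

theorem ExtVanishes.of_retract {n : ℕ} (h : ExtVanishes B Y n) (s : X →ₗ[B] Y) (r : Y →ₗ[B] X)
    (hrs : r ∘ₗ s = LinearMap.id) : ExtVanishes B X n := by
  refine ⟨fun x y => ?_⟩
  have key : ∀ x : Abelian.Ext (ModuleCat.of B X) (ModuleCat.of B B) n, x = 0 := by
    intro x
    have h1 : (Abelian.Ext.mk₀ (ModuleCat.ofHom r)).comp x (zero_add n) = 0 :=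
      h.elim _ _
    have h2 : (Abelian.Ext.mk₀ (ModuleCat.ofHom s)).comp
        ((Abelian.Ext.mk₀ (ModuleCat.ofHom r)).comp x (zero_add n)) (zero_add n) = x := by
      rw [Abelian.Ext.mk₀_comp_mk₀_assoc, ← ModuleCat.ofHom_comp, hrs, ModuleCat.ofHom_id,
        Abelian.Ext.mk₀_id_comp]
    rw [← h2, h1, Abelian.Ext.comp_zero]
  rw [key x, key y]

theorem ExtVanishes.of_equiv {n : ℕ} (h : ExtVanishes B Y n) (f : X ≃ₗ[B] Y) :
    ExtVanishes B X n :=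
  h.of_retract f.toLinearMap f.symm.toLinearMap (by ext; simp)

theorem extVanishes_of_projective [Module.Projective B X] (n : ℕ) : ExtVanishes B X (n + 1) := by
  have : Projective (ModuleCat.of B X) := (IsProjective.iff_projective X).mp inferInstance
  exact Abelian.Ext.subsingleton_of_projective _ _ n

section ShortExact

variable {f : X →ₗ[B] Y} {g : Y →ₗ[B] Z} (hf : Function.Injective f)
  (hg : Function.Surjective g) (hfg : Function.Exact f g)

/-- The short exact sequence in `ModuleCat` given by a short exact sequence of linear maps. -/
abbrev shortComplexOfExact (hfg : Function.Exact f g) : ShortComplex (ModuleCat.{u} B) :=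
  ShortComplex.mk (ModuleCat.ofHom f) (ModuleCat.ofHom g) (by
    rw [← ModuleCat.ofHom_comp, hfg.linearMap_comp_eq_zero]; rfl)

include hf hg hfg

theorem shortComplexOfExact_shortExact : (shortComplexOfExact hfg).ShortExact :=
  ModuleCat.shortComplex_shortExact _ hfg hf hg

theorem ExtVanishes.left {n : ℕ} (hY : ExtVanishes B Y n) (hZ : ExtVanishes B Z (n + 1)) :
    ExtVanishes B X n := by
  have hS := shortComplexOfExact_shortExact hf hg hfg
  have key : ∀ x : Abelian.Ext (ModuleCat.of B X) (ModuleCat.of B B) n, x = 0 := by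
    intro x
    obtain ⟨y, hy⟩ := Abelian.Ext.contravariant_sequence_exact₁ hS (ModuleCat.of B B) x
      (add_comm 1 n) (hZ.elim _ _)
    rw [← hy, hY.elim y 0, Abelian.Ext.comp_zero]
  exact ⟨fun x y => by rw [key x, key y]⟩

theorem ExtVanishes.middle {n : ℕ} (hX : ExtVanishes B X n) (hZ : ExtVanishes B Z n) :
    ExtVanishes B Y n := by
  have hS := shortComplexOfExact_shortExact hf hg hfg
  have key : ∀ x : Abelian.Ext (ModuleCat.of B Y) (ModuleCat.of B B) n, x = 0 := by
    intro x
    obtain ⟨y, hy⟩ := Abelian.Ext.contravariant_sequence_exact₂ hS (ModuleCat.of B B) x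
      (hX.elim _ _)
    rw [← hy, hZ.elim y 0, Abelian.Ext.comp_zero]
  exact ⟨fun x y => by rw [key x, key y]⟩

theorem ExtVanishes.right {n : ℕ} (hX : ExtVanishes B X n) (hY : ExtVanishes B Y (n + 1)) :
    ExtVanishes B Z (n + 1) := by
  have hS := shortComplexOfExact_shortExact hf hg hfg
  have key : ∀ x : Abelian.Ext (ModuleCat.of B Z) (ModuleCat.of B B) (n + 1), x = 0 := by
    intro x
    obtain ⟨y, hy⟩ := Abelian.Ext.contravariant_sequence_exact₃ hS (ModuleCat.of B B) x
      (hY.elim _ _) (add_comm 1 n)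
    rw [← hy, hX.elim y 0, Abelian.Ext.comp_zero]
  exact ⟨fun x y => by rw [key x, key y]⟩

/-- If `Ext^1(Z, B) = 0`, every map from a submodule with quotient `Z` to `B` extends. -/
theorem ExtVanishes.exists_extension (hZ : ExtVanishes B Z 1) (φ : X →ₗ[B] B) :
    ∃ ψ : Y →ₗ[B] B, ψ ∘ₗ f = φ := by
  have hS := shortComplexOfExact_shortExact hf hg hfg
  obtain ⟨y, hy⟩ := Abelian.Ext.contravariant_sequence_exact₁ hS (ModuleCat.of B B)
    (Abelian.Ext.mk₀ (ModuleCat.ofHom φ)) (add_zero 1) (hZ.elim _ _)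
  obtain ⟨ψ, rfl⟩ := (Abelian.Ext.mk₀_bijective _ _).2 y
  rw [Abelian.Ext.mk₀_comp_mk₀] at hy
  have := (Abelian.Ext.mk₀_bijective _ _).1 hy
  exact ⟨ψ.hom, by simpa using congrArg ModuleCat.Hom.hom this⟩

end ShortExact

end Ext

/-! ### Lengths -/

section Length

/-- The length of a module as a natural number; `0` if the length is infinite. -/
noncomputable def len (R : Type*) [Ring R] (X : Type*) [AddCommGroup X] [Module R X] : ℕ :=
  (Module.length R X).toNat

variable {R : Type*} [Ring R] {X Y Z : Type*} [AddCommGroup X] [Module R X] [AddCommGroup Y]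
  [Module R Y] [AddCommGroup Z] [Module R Z]

theorem len_congr (f : X ≃ₗ[R] Y) : len R X = len R Y := by
  rw [len, len, f.length_eq]

theorem len_top : len R (⊤ : Submodule R X) = len R X := len_congr Submodule.topEquiv

theorem cast_len [IsArtinianRing R] [Module.Finite R X] : (len R X : ℕ∞) = Module.length R X :=
  ENat.natCast_toNat Module.length_ne_top

theorem len_eq_of_length_eq {n : ℕ} (h : Module.length R X = n) : len R X = n := by
  rw [len, h]; rfl

theorem len_add_of_exact [IsArtinianRing R] [Module.Finite R Y] {f : X →ₗ[R] Y} {g : Y →ₗ[R] Z}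
    (hf : Function.Injective f) (hg : Function.Surjective g) (hfg : Function.Exact f g) :
    len R Y = len R X + len R Z := by
  have := Module.Finite.of_surjective g hg
  have := Module.Finite.of_injective f hf
  have h := Module.length_eq_add_of_exact f g hf hg hfg
  rw [← cast_len (X := X), ← cast_len (X := Y), ← cast_len (X := Z)] at h
  exact_mod_cast h

theorem len_add_quotient [IsArtinianRing R] [Module.Finite R X] (N : Submodule R X) :
    len R X = len R N + len R (X ⧸ N) :=
  len_add_of_exact N.injective_subtype N.mkQ_surjective (LinearMap.exact_subtype_mkQ N)

theorem len_range_add_ker [IsArtinianRing R] [Module.Finite R X] (f : X →ₗ[R] Y) :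
    len R X = len R (LinearMap.ker f) + len R (LinearMap.range f) := by
  rw [len_add_quotient (LinearMap.ker f), len_congr f.quotKerEquivRange]

theorem len_pi (R : Type*) [Ring R] [IsArtinianRing R] (X : Type*) [AddCommGroup X] [Module R X]
    [Module.Finite R X] (n : ℕ) : len R (Fin n → X) = n * len R X := by
  have : Module.length R (Fin n → X) = ((n * len R X : ℕ) : ℕ∞) := by
    rw [Module.length_pi_of_fintype]; push_cast; simp [cast_len]
  exact len_eq_of_length_eq this

theorem len_le_of_injective [IsArtinianRing R] [Module.Finite R Y] (f : X →ₗ[R] Y)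
    (hf : Function.Injective f) : len R X ≤ len R Y := by
  rw [len_add_quotient (LinearMap.range f), len_congr (LinearEquiv.ofInjective f hf)]
  exact Nat.le_add_right _ _

theorem len_eq_zero_iff [IsArtinianRing R] [Module.Finite R X] :
    len R X = 0 ↔ Subsingleton X := by
  rw [← Module.length_eq_zero_iff (R := R), ← cast_len]; norm_cast

theorem eq_top_of_len_le [IsArtinianRing R] [Module.Finite R X] {N : Submodule R X}
    (h : len R X ≤ len R N) : N = ⊤ := by
  rw [len_add_quotient N] at h
  have : len R (X ⧸ N) = 0 := by omega
  rw [len_eq_zero_iff] at this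
  exact Submodule.Quotient.subsingleton_iff.mp this

theorem eq_of_le_of_len_le [IsArtinianRing R] [Module.Finite R X] {N N' : Submodule R X}
    (hle : N ≤ N') (h : len R N' ≤ len R N) : N = N' := by
  have h1 : N.submoduleOf N' = ⊤ := eq_top_of_len_le
    (h.trans (len_congr (Submodule.submoduleOfEquivOfLe hle)).ge)
  exact le_antisymm hle (Submodule.submoduleOf_eq_top.mp h1)

end Length

/-! ### The radical of a local ring and its simple module -/

section LocalRing

variable (A : Type u) [Ring A]

/-- The quotient `A / J`, which is the simple module when `A` is local. -/
abbrev Residue : Type u := A ⧸ Ring.jacobson A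

variable {A} {X : Type u} [AddCommGroup X] [Module A X]

/-- The map `A / J → X` sending `1` to an element `x` with `J x = 0`. -/
def residueMap (x : X) (hx : ∀ r ∈ Ring.jacobson A, r • x = 0) : Residue A →ₗ[A] X :=
  Submodule.liftQ _ (LinearMap.toSpanSingleton A X x) fun r hr => by simpa using hx r hr

theorem residueMap_mk (x : X) (hx : ∀ r ∈ Ring.jacobson A, r • x = 0) (r : A) :
    residueMap x hx (Submodule.Quotient.mk r) = r • x :=
  rfl

end LocalRing

section LocalRing

variable {A : Type u} [Ring A] [IsLocalRing A]

/-- Left invertible elements are units, as a local ring has no idempotents except `0` and `1`. -/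
theorem isUnit_of_mul_eq_one {x y : A} (h : y * x = 1) : IsUnit x := by
  have hidem : (x * y) * (x * y) = x * y := by
    rw [mul_assoc, ← mul_assoc y, h, one_mul]
  rcases IsLocalRing.isUnit_or_isUnit_of_add_one (a := x * y) (b := 1 - x * y) (by abel)
    with hu | hu
  · have h1 : x * y = 1 := hu.mul_left_cancel (by rw [hidem, mul_one])
    exact ⟨⟨x, y, h1, h⟩, rfl⟩
  · have h0 : x * y = 0 := hu.mul_right_cancel (by rw [mul_sub, hidem, mul_one, sub_self, zero_mul])
    have : (1 : A) = 0 := by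
      calc (1 : A) = (y * x) * (y * x) := by rw [h, one_mul]
        _ = y * (x * y) * x := by simp only [mul_assoc]
        _ = 0 := by rw [h0, mul_zero, zero_mul]
    exact absurd this one_ne_zero

theorem mem_jacobson_iff {x : A} : x ∈ Ring.jacobson A ↔ ¬ IsUnit x := by
  constructor
  · intro hx hu
    exact (Ring.jacobson_lt_top A).ne (Ideal.eq_top_of_isUnit_mem _ hx hu)
  · intro hx
    refine Submodule.mem_sInf.mpr fun m hm => ?_
    by_contra hxm
    have htop : m ⊔ Submodule.span A {x} = ⊤ := by
      refine hm.2 _ (lt_of_le_of_ne le_sup_left fun h => hxm ?_)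
      rw [h]
      exact Submodule.mem_sup_right (Submodule.mem_span_singleton_self x)
    have h1 : (1 : A) ∈ m ⊔ Submodule.span A {x} := htop ▸ Submodule.mem_top
    obtain ⟨y, hy, z, hz, hyz⟩ := Submodule.mem_sup.mp h1
    obtain ⟨r, rfl⟩ := Submodule.mem_span_singleton.mp hz
    rcases IsLocalRing.isUnit_or_isUnit_of_add_one hyz with hu | hu
    · exact hm.1 (Ideal.eq_top_of_isUnit_mem m hy hu)
    · obtain ⟨u, hu⟩ := hu
      refine hx (isUnit_of_mul_eq_one (y := ↑u⁻¹ * r) ?_)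
      rw [mul_assoc, ← smul_eq_mul r x, ← hu, Units.inv_mul]

theorem le_jacobson_of_ne_top {I : Ideal A} (h : I ≠ ⊤) : I ≤ Ring.jacobson A := fun _ hx =>
  mem_jacobson_iff.mpr fun hu => h (Ideal.eq_top_of_isUnit_mem I hx hu)

instance : IsSimpleModule A (Residue A) := by
  rw [isSimpleModule_iff_isCoatom]
  refine ⟨(Ring.jacobson_lt_top A).ne, fun I hI => ?_⟩
  by_contra h
  exact hI.not_ge (le_jacobson_of_ne_top h)

variable {X : Type u} [AddCommGroup X] [Module A X]

theorem residueMap_injective {x : X} (hx : ∀ r ∈ Ring.jacobson A, r • x = 0) (h0 : x ≠ 0) :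
    Function.Injective (residueMap x hx) := by
  refine (LinearMap.injective_or_eq_zero _).resolve_right fun h => h0 ?_
  have := residueMap_mk x hx 1
  rw [h] at this
  simpa using this.symm

theorem exists_residue_equiv [IsSimpleModule A X] : Nonempty (X ≃ₗ[A] Residue A) := by
  have := IsSimpleModule.nontrivial A X
  obtain ⟨x, hx⟩ := exists_ne (0 : X)
  have hJ : ∀ r ∈ Ring.jacobson A, r • x = 0 := fun r hr =>
    Module.mem_annihilator.mp (IsSemisimpleModule.jacobson_le_annihilator A X hr) x
  exact ⟨(LinearEquiv.ofBijective (residueMap x hJ)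
    (LinearMap.bijective_of_ne_zero fun h => hx (by
      have := residueMap_mk x hJ 1
      rw [h] at this
      simpa using this.symm))).symm⟩

theorem isIsotypicOfType_residue : IsIsotypicOfType A X (Residue A) := fun _ _ =>
  exists_residue_equiv

end LocalRing

section Semisimple

variable {A : Type u} [Ring A] {X : Type u} [AddCommGroup X] [Module A X]

theorem jacobson_smul_quotient (r : A) (hr : r ∈ Ring.jacobson A)
    (x : X ⧸ Ring.jacobson A • (⊤ : Submodule A X)) : r • x = 0 := by
  obtain ⟨x, rfl⟩ := Submodule.Quotient.mk_surjective _ x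
  rw [← Submodule.Quotient.mk_smul, Submodule.Quotient.mk_eq_zero]
  exact Submodule.smul_mem_smul hr trivial

/-- A nonzero finite module over a local ring has the simple module as a quotient. -/
theorem exists_surjective_residue [IsLocalRing A] [Nontrivial X] [Module.Finite A X] :
    ∃ f : X →ₗ[A] Residue A, Function.Surjective f := by
  obtain ⟨m, hm, -⟩ := (eq_top_or_exists_le_coatom (⊥ : Submodule A X)).resolve_left bot_ne_top
  have := isSimpleModule_iff_isCoatom.mpr hm
  obtain ⟨e⟩ := exists_residue_equiv (A := A) (X := X ⧸ m)
  exact ⟨e.toLinearMap ∘ₗ m.mkQ, e.surjective.comp m.mkQ_surjective⟩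

variable [IsArtinianRing A]

theorem isSemisimpleModule_of_jacobson_smul
    (h : ∀ r ∈ Ring.jacobson A, ∀ x : X, r • x = 0) : IsSemisimpleModule A X := by
  have h' : Module.IsTorsionBySet A X (Ring.jacobson A) := fun x r => h r.1 r.2 x
  let _ := h'.module
  exact (h'.semilinearMap.isSemisimpleModule_iff_of_bijective Function.bijective_id).2
    inferInstance

instance : IsSemisimpleModule A (X ⧸ Ring.jacobson A • (⊤ : Submodule A X)) :=
  isSemisimpleModule_of_jacobson_smul jacobson_smul_quotient

variable (A X) in
theorem module_jacobson_eq : Module.jacobson A X = Ring.jacobson A • (⊤ : Submodule A X) :=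
  le_antisymm (Module.jacobson_le_of_eq_bot (IsSemisimpleModule.jacobson_eq_bot _ _))
    (Ring.jacobson_smul_top_le A X)

variable [IsLocalRing A]

theorem exists_equiv_pi_residue [IsSemisimpleModule A X] [Module.Finite A X] :
    Nonempty (X ≃ₗ[A] (Fin (len A X) → Residue A)) := by
  obtain ⟨n, ⟨f⟩⟩ := IsIsotypicOfType.linearEquiv_fun
    (isIsotypicOfType_residue (A := A) (X := X))
  have h : len A X = n := by
    rw [len_congr f, len_pi, len_eq_of_length_eq (n := 1) (by simp [Module.length_eq_one]), mul_one]
  exact ⟨f.trans (LinearEquiv.funCongrLeft A _ (finCongr h))⟩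

/-- An element of `X` annihilated by `J` and outside `J X` spans a direct summand. -/
theorem exists_retract_of_notMem {x : X} (hx : ∀ r ∈ Ring.jacobson A, r • x = 0)
    (hx' : x ∉ Ring.jacobson A • (⊤ : Submodule A X)) :
    ∃ (s : Residue A →ₗ[A] X) (r : X →ₗ[A] Residue A), r ∘ₗ s = LinearMap.id := by
  let q := (Ring.jacobson A • (⊤ : Submodule A X)).mkQ
  have hinj : Function.Injective (q ∘ₗ residueMap x hx) := by
    refine (LinearMap.injective_or_eq_zero _).resolve_right fun h => hx' ?_
    have := LinearMap.congr_fun h (Submodule.Quotient.mk 1)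
    rw [LinearMap.comp_apply, residueMap_mk, one_smul] at this
    exact (Submodule.Quotient.mk_eq_zero _).mp this
  obtain ⟨r, hr⟩ := IsSemisimpleModule.extension_property _ hinj LinearMap.id
  exact ⟨residueMap x hx, r ∘ₗ q, by rw [LinearMap.comp_assoc, hr]⟩

end Semisimple

/-! ### Lengths over the base ring -/

section BaseLength

variable {k : Type v} [CommRing k] {A : Type u} [Ring A] [Algebra k A] [Module.Finite k A]

variable (k) in
theorem finite_of_tower (X : Type*) [AddCommGroup X] [Module A X] [Module k X] [IsScalarTower k A X]
    [Module.Finite A X] : Module.Finite k X := Module.Finite.trans A X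

variable [IsArtinianRing k]

variable (k A) in
theorem finite_hom (X Y : Type*) [AddCommGroup X] [Module A X] [AddCommGroup Y] [Module A Y]
    [Module k Y] [IsScalarTower k A Y] [SMulCommClass A k Y] [Module.Finite A X]
    [Module.Finite A Y] : Module.Finite k (X →ₗ[A] Y) := by
  obtain ⟨n, f, hf⟩ := Module.Finite.exists_fin' A X
  have := finite_of_tower k (A := A) Y
  have : Module.Finite k ((Fin n → A) →ₗ[A] Y) :=
    Module.Finite.equiv (LinearMap.lsum A (fun _ : Fin n => A) k (M := Y))
  exact Module.Finite.of_injective (LinearMap.lcomp k Y f)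
    (LinearMap.lcomp_injective_of_surjective f hf)

variable [IsLocalRing A]

variable (k A) in
/-- The length over the base ring of the simple module. -/
noncomputable def resLen : ℕ := len k (Residue A)

theorem resLen_pos : 0 < resLen k A := by
  have := finite_of_tower k (A := A) (Residue A)
  rw [resLen, Nat.pos_iff_ne_zero, Ne, len_eq_zero_iff]
  have := IsSimpleModule.nontrivial A (Residue A)
  exact not_subsingleton _

/-- Every composition factor of `X` contributes `resLen k A` to the length over `k`. -/
theorem len_base (X : Type u) [AddCommGroup X] [Module A X] [Module k X] [IsScalarTower k A X]
    [Module.Finite A X] : len k X = resLen k A * len A X := by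
  have : IsArtinianRing A := IsArtinianRing.of_finite k A
  obtain ⟨n, hn⟩ : ∃ n, len A X = n := ⟨_, rfl⟩
  induction n generalizing X with
  | zero =>
    have := finite_of_tower k (A := A) X
    rw [hn, mul_zero, len_eq_zero_iff]
    rwa [len_eq_zero_iff] at hn
  | succ n ih =>
    have : Nontrivial X := by
      rw [← not_subsingleton_iff_nontrivial, ← len_eq_zero_iff (R := A)]
      omega
    have := finite_of_tower k (A := A) X
    obtain ⟨f, hf⟩ := exists_surjective_residue (A := A) (X := X)
    have hA := len_add_of_exact (LinearMap.ker f).injective_subtype hf f.exact_subtype_ker_map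
    have hk := len_add_of_exact (R := k)
      (f := (LinearMap.ker f).subtype.restrictScalars k) (g := f.restrictScalars k)
      (LinearMap.ker f).injective_subtype hf f.exact_subtype_ker_map
    have h1 : len A (Residue A) = 1 := len_eq_of_length_eq (by simp [Module.length_eq_one])
    rw [hk, hA, ih (LinearMap.ker f) (by omega), h1, mul_add, mul_one, resLen]

/-- For modules annihilated by `J`, lengths of `Hom` multiply. -/
theorem len_hom_semisimple (X Y : Type u) [AddCommGroup X] [Module A X] [Module.Finite A X]
    [AddCommGroup Y] [Module A Y] [Module k Y] [IsScalarTower k A Y] [SMulCommClass A k Y]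
    [Module.Finite A Y]
    (hX : ∀ r ∈ Ring.jacobson A, ∀ x : X, r • x = 0)
    (hY : ∀ r ∈ Ring.jacobson A, ∀ y : Y, r • y = 0) :
    len k (X →ₗ[A] Y) = resLen k A * (len A Y * len A X) := by
  have : IsArtinianRing A := IsArtinianRing.of_finite k A
  have := isSemisimpleModule_of_jacobson_smul hX
  obtain ⟨e⟩ := exists_equiv_pi_residue (A := A) (X := X)
  have := finite_of_tower k (A := A) Y
  have := finite_hom k A (Residue A) Y
  let e0 : (Residue A →ₗ[A] Y) ≃ₗ[k] Y :=
    { toFun := fun f => f (Submodule.Quotient.mk 1)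
      map_add' := fun _ _ => rfl
      map_smul' := fun _ _ => rfl
      invFun := fun y => residueMap y fun r hr => hY r hr y
      left_inv := fun f => by
        refine LinearMap.ext fun x => ?_
        obtain ⟨r, rfl⟩ := Submodule.Quotient.mk_surjective _ x
        rw [residueMap_mk, ← map_smul, ← Submodule.Quotient.mk_smul, smul_eq_mul, mul_one]
      right_inv := fun y => one_smul A y }
  rw [len_congr (LinearEquiv.congrLeft Y k e),
    ← len_congr (LinearMap.lsum A (fun _ : Fin (len A X) => Residue A) k (M := Y)), len_pi,
    len_congr e0, len_base (k := k) (A := A) Y]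
  ring

end BaseLength

/-! ### Self-injectivity -/

section Socle

variable {A : Type u} [Ring A] [IsArtinianRing A] [IsLocalRing A]

theorem exists_socle_element :
    ∃ x : A, x ≠ 0 ∧ ∀ r ∈ Ring.jacobson A, r * x = 0 := by
  obtain ⟨m, hm, -⟩ := (eq_bot_or_exists_atom_le (⊤ : Submodule A A)).resolve_left top_ne_bot
  have : IsSimpleModule A m := isSimpleModule_iff_isAtom.mpr hm
  obtain ⟨x, hx, hx0⟩ := (Submodule.ne_bot_iff m).mp hm.1
  refine ⟨x, hx0, fun r hr => ?_⟩
  have := Module.mem_annihilator.mp (IsSemisimpleModule.jacobson_le_annihilator A m hr) ⟨x, hx⟩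
  exact congrArg Subtype.val this

/-- Vanishing of `Ext^n(-, A)` on all finite modules can be tested on the simple module. -/
theorem ExtVanishes.of_residue {n : ℕ} (h : ExtVanishes A (Residue A) n) (X : Type u)
    [AddCommGroup X] [Module A X] [Module.Finite A X] : ExtVanishes A X n := by
  obtain ⟨l, hl⟩ : ∃ l, len A X = l := ⟨_, rfl⟩
  induction l generalizing X with
  | zero =>
    rw [len_eq_zero_iff] at hl
    exact h.of_retract 0 0 (Subsingleton.elim _ _)
  | succ l ih =>
    have : Nontrivial X := by
      rw [← not_subsingleton_iff_nontrivial, ← len_eq_zero_iff (R := A)]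
      omega
    obtain ⟨f, hf⟩ := exists_surjective_residue (A := A) (X := X)
    have hA := len_add_of_exact (LinearMap.ker f).injective_subtype hf f.exact_subtype_ker_map
    have h1 : len A (Residue A) = 1 := len_eq_of_length_eq (by simp [Module.length_eq_one])
    exact (ih (LinearMap.ker f) (by omega)).middle (LinearMap.ker f).injective_subtype hf
      f.exact_subtype_ker_map h

/-- If `Ext^i(A / J, A) = 0` for all large `i`, then `A` is self-injective: `A / J` embeds into
`A`, so the highest degree `n ≥ 1` with `Ext^n(A / J, A) ≠ 0` would be subject to
`Ext^n(A, A) → Ext^n(A / J, A) → Ext^{n+1}(C, A) = 0`. -/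
theorem injective_of_extVanishes_residue {n₀ : ℕ}
    (h : ∀ i, n₀ ≤ i → ExtVanishes A (Residue A) i) : Module.Injective A A := by
  obtain ⟨x, hx0, hx⟩ := exists_socle_element (A := A)
  have hinj := residueMap_injective (A := A) hx hx0
  have key : ∀ j, ∀ i, n₀ ≤ i + j → 1 ≤ i → ExtVanishes A (Residue A) i := by
    intro j
    induction j with
    | zero => exact fun i hi _ => h i hi
    | succ j ih =>
      intro i hi h1
      obtain ⟨i, rfl⟩ := Nat.exists_eq_add_of_le' h1
      exact (extVanishes_of_projective i).left hinj
        (LinearMap.range (residueMap x hx)).mkQ_surjective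
        (LinearMap.exact_map_mkQ_range _) ((ih (i + 1 + 1) (by omega) (by omega)).of_residue _)
  have h1 := key n₀ 1 (by omega) le_rfl
  refine Module.Baer.injective fun I g => ?_
  obtain ⟨ψ, hψ⟩ := (h1.of_residue (A ⧸ I)).exists_extension I.injective_subtype I.mkQ_surjective
    (LinearMap.exact_subtype_mkQ I) g
  exact ⟨ψ, fun x hx => LinearMap.congr_fun hψ ⟨x, hx⟩⟩

/-- Over a ring which is not self-injective, a module with eventually vanishing `Ext` into the
ring has no simple direct summand. -/
theorem mem_jacobson_smul_of_extVanishes (hA : ¬ Module.Injective A A) {X : Type u}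
    [AddCommGroup X] [Module A X] {n₀ : ℕ} (h : ∀ i, n₀ ≤ i → ExtVanishes A X i) {x : X}
    (hx : ∀ r ∈ Ring.jacobson A, r • x = 0) : x ∈ Ring.jacobson A • (⊤ : Submodule A X) := by
  by_contra hx'
  obtain ⟨s, r, hrs⟩ := exists_retract_of_notMem hx hx'
  exact hA (injective_of_extVanishes_residue fun i hi => (h i hi).of_retract s r hrs)

end Socle

section Hom

variable {k : Type v} [CommRing k] [IsArtinianRing k]
  {A : Type u} [Ring A] [Algebra k A] [Module.Finite k A]
  {X Y Z : Type u} [AddCommGroup X] [Module A X] [AddCommGroup Y] [Module A Y]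
  [AddCommGroup Z] [Module A Z] [Module.Finite A Y]
  {f : X →ₗ[A] Y} {g : Y →ₗ[A] Z}

theorem len_hom_of_exact (hg : Function.Surjective g) (hfg : Function.Exact f g) :
    len k (Y →ₗ[A] A) = len k (Z →ₗ[A] A) + len k (LinearMap.range (LinearMap.lcomp k A f)) := by
  have := finite_hom k A Y A
  refine len_add_of_exact (f := LinearMap.lcomp k A g) (g := (LinearMap.lcomp k A f).rangeRestrict)
    (LinearMap.lcomp_injective_of_surjective g hg) (LinearMap.surjective_rangeRestrict _) ?_
  intro φ
  have h1 : (LinearMap.lcomp k A f).rangeRestrict φ = 0 ↔ φ ∘ₗ f = 0 := by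
    rw [← Subtype.coe_inj]; rfl
  rw [h1]
  constructor
  · exact exists_factor hg hfg φ
  · rintro ⟨ψ, rfl⟩
    refine LinearMap.ext fun x => ?_
    change ψ (g (f x)) = 0
    rw [hfg.apply_apply_eq_zero, map_zero]

theorem len_hom_le_of_exact (hf : Function.Injective f) (hg : Function.Surjective g)
    (hfg : Function.Exact f g) :
    len k (Y →ₗ[A] A) ≤ len k (X →ₗ[A] A) + len k (Z →ₗ[A] A) := by
  have : IsArtinianRing A := IsArtinianRing.of_finite k A
  have := Module.Finite.of_injective f hf
  have := finite_hom k A X A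
  rw [len_hom_of_exact hg hfg, add_comm]
  exact Nat.add_le_add_right (len_le_of_injective _ (Submodule.injective_subtype _)) _

theorem len_hom_eq_of_exact (hg : Function.Surjective g)
    (hfg : Function.Exact f g) (hext : ∀ φ : X →ₗ[A] A, ∃ ψ : Y →ₗ[A] A, ψ ∘ₗ f = φ) :
    len k (Y →ₗ[A] A) = len k (X →ₗ[A] A) + len k (Z →ₗ[A] A) := by
  have htop : LinearMap.range (LinearMap.lcomp k A f) = ⊤ := LinearMap.range_eq_top.mpr hext
  rw [len_hom_of_exact hg hfg, add_comm, htop,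
    len_top]

theorem len_hom_self (k : Type v) [CommRing k] (A : Type u) [Ring A] [Algebra k A] :
    len k (A →ₗ[A] A) = len k A :=
  len_congr (LinearMap.ringLmapEquivSelf A k A)

end Hom

section SelfInjective

variable {k : Type v} [CommRing k] [IsArtinianRing k]
  {A : Type u} [Ring A] [Algebra k A] [Module.Finite k A] [IsLocalRing A]

/-- Induction on the length of `X`, as `Hom (-, A)` is left exact. -/
theorem len_hom_le (X : Type u) [AddCommGroup X] [Module A X] [Module.Finite A X] :
    len k (X →ₗ[A] A) ≤ len k (Residue A →ₗ[A] A) * len A X := by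
  have : IsArtinianRing A := IsArtinianRing.of_finite k A
  obtain ⟨l, hl⟩ : ∃ l, len A X = l := ⟨_, rfl⟩
  induction l generalizing X with
  | zero =>
    rw [hl, mul_zero, Nat.le_zero]
    have := finite_hom k A X A
    rw [len_eq_zero_iff] at hl ⊢
    exact ⟨fun f g => LinearMap.ext fun x => by rw [Subsingleton.elim x 0, map_zero, map_zero]⟩
  | succ l ih =>
    have : Nontrivial X := by
      rw [← not_subsingleton_iff_nontrivial, ← len_eq_zero_iff (R := A)]
      omega
    obtain ⟨f, hf⟩ := exists_surjective_residue (A := A) (X := X)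
    have hA := len_add_of_exact (LinearMap.ker f).injective_subtype hf f.exact_subtype_ker_map
    have h1 : len A (Residue A) = 1 := len_eq_of_length_eq (by simp [Module.length_eq_one])
    have := ih (LinearMap.ker f) (by omega)
    have h2 := len_hom_le_of_exact (k := k) (LinearMap.ker f).injective_subtype hf
      f.exact_subtype_ker_map
    rw [hA, h1, mul_add, mul_one]
    omega

/-- A local algebra whose left socle is simple is self-injective: then `|X^*| ≤ |X|` for all `X`,
with equality for `A`, so by counting every restriction `A^* → I^*` to a left ideal is surjective. -/
theorem injective_of_len_hom_residue_le (h : len k (Residue A →ₗ[A] A) ≤ resLen k A) :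
    Module.Injective A A := by
  have : IsArtinianRing A := IsArtinianRing.of_finite k A
  have hle : ∀ (X : Type u) [AddCommGroup X] [Module A X] [Module.Finite A X],
      len k (X →ₗ[A] A) ≤ resLen k A * len A X := fun X _ _ _ =>
    (len_hom_le X).trans (Nat.mul_le_mul_right _ h)
  refine Module.Baer.injective fun I g => ?_
  have h1 := len_hom_of_exact (k := k) I.mkQ_surjective (LinearMap.exact_subtype_mkQ I)
  have h2 := hle I
  have h3 := hle (A ⧸ I)
  have := finite_hom k A I A
  have htop : LinearMap.range (LinearMap.lcomp k A I.subtype) = ⊤ := by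
    apply eq_top_of_len_le
    rw [len_hom_self k A, len_base (k := k) (A := A) A, len_add_quotient I, mul_add] at h1
    omega
  obtain ⟨ψ, hψ⟩ := LinearMap.range_eq_top.mp htop g
  exact ⟨ψ, fun x hx => LinearMap.congr_fun hψ ⟨x, hx⟩⟩

/-- Over a self-injective local algebra, dualizing preserves lengths. -/
theorem len_hom_eq_of_injective (hA : Module.Injective A A) (X : Type u) [AddCommGroup X]
    [Module A X] [Module.Finite A X] : len k (X →ₗ[A] A) = resLen k A * len A X := by
  have : IsArtinianRing A := IsArtinianRing.of_finite k A
  have key : ∀ (X : Type u) [AddCommGroup X] [Module A X] [Module.Finite A X],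
      len k (X →ₗ[A] A) = len k (Residue A →ₗ[A] A) * len A X := by
    intro X _ _ _
    obtain ⟨l, hl⟩ : ∃ l, len A X = l := ⟨_, rfl⟩
    induction l generalizing X with
    | zero =>
      exact le_antisymm (len_hom_le X) (by rw [hl, mul_zero]; exact Nat.zero_le _)
    | succ l ih =>
      have : Nontrivial X := by
        rw [← not_subsingleton_iff_nontrivial, ← len_eq_zero_iff (R := A)]
        omega
      obtain ⟨f, hf⟩ := exists_surjective_residue (A := A) (X := X)
      have hl' := len_add_of_exact (LinearMap.ker f).injective_subtype hf f.exact_subtype_ker_map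
      have h1 : len A (Residue A) = 1 := len_eq_of_length_eq (by simp [Module.length_eq_one])
      have h2 := len_hom_eq_of_exact (k := k) hf f.exact_subtype_ker_map fun φ => by
        obtain ⟨ψ, hψ⟩ := hA.out _ (LinearMap.ker f).injective_subtype φ
        exact ⟨ψ, LinearMap.ext hψ⟩
      rw [h2, ih (LinearMap.ker f) (by omega), hl', h1, mul_add, mul_one]
  have h := key A
  rw [len_hom_self k A, len_base (k := k) (A := A) A] at h
  have hpos : 0 < len A A := by
    rw [Nat.pos_iff_ne_zero, Ne, len_eq_zero_iff]
    exact not_subsingleton A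
  rw [key X, Nat.eq_of_mul_eq_mul_right hpos h]

end SelfInjective

section Opposite

instance {A : Type u} [Ring A] [IsLocalRing A] : IsLocalRing Aᵐᵒᵖ where
  isUnit_or_isUnit_of_add_one {a b} h := by
    have h' : b.unop + a.unop = 1 := by
      rw [add_comm, ← MulOpposite.unop_add, h, MulOpposite.unop_one]
    rcases IsLocalRing.isUnit_or_isUnit_of_add_one h' with hu | hu
    · exact Or.inr (MulOpposite.op_unop b ▸ hu.op)
    · exact Or.inl (MulOpposite.op_unop a ▸ hu.op)

theorem op_mem_jacobson {A : Type u} [Ring A] [IsLocalRing A] {x : A} :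
    MulOpposite.op x ∈ Ring.jacobson Aᵐᵒᵖ ↔ x ∈ Ring.jacobson A := by
  rw [mem_jacobson_iff, mem_jacobson_iff, isUnit_op]

variable {k : Type v} [CommRing k] [IsArtinianRing k]
  {A : Type u} [Ring A] [Algebra k A] [Module.Finite k A]

variable (k A) in
theorem len_jacobson_add_resLen : len k (Ring.jacobson A) + resLen k A = len k A := by
  have := finite_of_tower k (A := A) A
  refine (len_add_of_exact (f := (Ring.jacobson A).subtype.restrictScalars k)
    (g := (Ring.jacobson A).mkQ.restrictScalars k) (Ring.jacobson A).injective_subtype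
    (Ring.jacobson A).mkQ_surjective (LinearMap.exact_subtype_mkQ (Ring.jacobson A))).symm

variable [IsLocalRing A]

variable (k A) in
theorem resLen_op : resLen k Aᵐᵒᵖ = resLen k A := by
  have h1 := len_jacobson_add_resLen k A
  have h2 := len_jacobson_add_resLen k Aᵐᵒᵖ
  have h3 : len k A = len k Aᵐᵒᵖ := len_congr (MulOpposite.opLinearEquiv k)
  have h4 : len k (Ring.jacobson A) = len k (Ring.jacobson Aᵐᵒᵖ) := len_congr
    { toFun := fun x => ⟨MulOpposite.op x.1, op_mem_jacobson.mpr x.2⟩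
      map_add' := fun _ _ => rfl
      map_smul' := fun _ _ => rfl
      invFun := fun y => ⟨y.1.unop, op_mem_jacobson.mp y.2⟩
      left_inv := fun _ => rfl
      right_inv := fun _ => rfl }
  omega

variable (A) in
/-- The right socle `{x | x J = 0}`, as a left ideal. -/
def rightSocle : Submodule A A where
  carrier := {x | ∀ r ∈ Ring.jacobson A, x * r = 0}
  add_mem' hx hy r hr := by rw [add_mul, hx r hr, hy r hr, add_zero]
  zero_mem' r _ := zero_mul r
  smul_mem' c x hx r hr := by rw [smul_eq_mul, mul_assoc, hx r hr, mul_zero]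

/-- If `A` is left self-injective, its right socle `S` is at most as long as the simple module:
right multiplications embed `J` into `Hom (A / S, A)`, which has the length of `A / S`. -/
theorem len_rightSocle_le (hA : Module.Injective A A) :
    len k (rightSocle A) ≤ resLen k A := by
  have : IsArtinianRing A := IsArtinianRing.of_finite k A
  have := finite_hom k A (A ⧸ rightSocle A) A
  let F : Ring.jacobson A →ₗ[k] (A ⧸ rightSocle A →ₗ[A] A) :=
    { toFun := fun x => (rightSocle A).liftQ (LinearMap.toSpanSingleton A A x.1)
        fun t ht => ht x.1 x.2
      map_add' := fun x y => by
        refine Submodule.linearMap_qext _ (LinearMap.ext fun r => ?_)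
        exact mul_add r x.1 y.1
      map_smul' := fun c x => by
        refine Submodule.linearMap_qext _ (LinearMap.ext fun r => ?_)
        exact mul_smul_comm c r x.1 }
  have hF : Function.Injective F := by
    intro x y hxy
    have h : (1 : A) * x.1 = 1 * y.1 := LinearMap.congr_fun hxy (Submodule.Quotient.mk 1)
    rw [one_mul, one_mul] at h
    exact Subtype.ext h
  have h1 := len_le_of_injective F hF
  rw [len_hom_eq_of_injective (k := k) hA] at h1
  have h2 := len_jacobson_add_resLen k A
  rw [len_base (k := k) (A := A) A, len_add_quotient (rightSocle A), mul_add,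
    ← len_base (k := k) (A := A) (rightSocle A)] at h2
  omega

/-- The right socle receives all homomorphisms from the simple right module, so that
`len_rightSocle_le` allows to apply `injective_of_len_hom_residue_le` to the opposite ring. -/
theorem injective_op (k : Type v) [CommRing k] [IsArtinianRing k]
    {A : Type u} [Ring A] [Algebra k A] [Module.Finite k A] [IsLocalRing A]
    (hA : Module.Injective A A) : Module.Injective Aᵐᵒᵖ Aᵐᵒᵖ := by
  have : IsArtinianRing A := IsArtinianRing.of_finite k A
  apply injective_of_len_hom_residue_le (k := k)
  rw [resLen_op]
  refine le_trans ?_ (len_rightSocle_le (k := k) hA)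
  have := finite_of_tower k (A := A) (rightSocle A)
  refine len_le_of_injective
    { toFun := fun f => ⟨(f (Submodule.Quotient.mk 1)).unop, fun r hr => ?_⟩
      map_add' := fun _ _ => rfl
      map_smul' := fun _ _ => rfl } ?_
  · have h : MulOpposite.op r • (Submodule.Quotient.mk 1 : Residue Aᵐᵒᵖ) = 0 := by
      rw [← Submodule.Quotient.mk_smul, Submodule.Quotient.mk_eq_zero, smul_eq_mul, mul_one]
      exact op_mem_jacobson.mpr hr
    have h' := congrArg f h
    rw [map_smul, map_zero] at h'
    exact congrArg MulOpposite.unop h'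
  · intro f g hfg
    have h : f (Submodule.Quotient.mk 1) = g (Submodule.Quotient.mk 1) :=
      MulOpposite.unop_injective (congrArg Subtype.val hfg)
    refine Submodule.linearMap_qext _ (LinearMap.ext_ring h)

theorem injective_of_op (k : Type v) [CommRing k] [IsArtinianRing k]
    {A : Type u} [Ring A] [Algebra k A] [Module.Finite k A] [IsLocalRing A]
    (hA : Module.Injective Aᵐᵒᵖ Aᵐᵒᵖ) : Module.Injective A A := by
  have : IsArtinianRing Aᵐᵒᵖ := IsArtinianRing.of_finite k Aᵐᵒᵖ
  apply injective_of_len_hom_residue_le (k := k)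
  rw [← resLen_op]
  refine le_trans ?_ (len_rightSocle_le (k := k) hA)
  have := finite_of_tower k (A := Aᵐᵒᵖ) (rightSocle Aᵐᵒᵖ)
  refine len_le_of_injective
    { toFun := fun f => ⟨MulOpposite.op (f (Submodule.Quotient.mk 1)), fun r hr => ?_⟩
      map_add' := fun _ _ => rfl
      map_smul' := fun _ _ => rfl } ?_
  · have h : r.unop • (Submodule.Quotient.mk 1 : Residue A) = 0 := by
      rw [← Submodule.Quotient.mk_smul, Submodule.Quotient.mk_eq_zero, smul_eq_mul, mul_one]
      exact op_mem_jacobson.mp hr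
    have h' := congrArg f h
    rw [map_smul, map_zero] at h'
    exact congrArg MulOpposite.op h'
  · intro f g hfg
    have h : f (Submodule.Quotient.mk 1) = g (Submodule.Quotient.mk 1) :=
      MulOpposite.op_injective (congrArg Subtype.val hfg)
    refine Submodule.linearMap_qext _ (LinearMap.ext_ring h)

end Opposite

/-! ### Short local rings and their opposites -/

section ShortType

/-- A short local ring with `|A| = 1 + e + a` and `|J ^ 2| = a`. -/
structure HasShortType (A : Type u) [Ring A] (e a : ℕ) : Prop where
  short : IsShort A
  len_ring : len A A = 1 + e + a
  len_sq : len A ↥(Ring.jacobson A ^ 2) = a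

theorem IsShort.hasShortType {A : Type u} [Ring A] [IsArtinianRing A] [IsLocalRing A] {e a : ℕ}
    (hs : IsShort A) (h : HasHilbertType A e a) : HasShortType A e a where
  short := hs
  len_sq := len_eq_of_length_eq h.2
  len_ring := by
    have hle : Ring.jacobson A ^ 2 ≤ Ring.jacobson A := Ideal.pow_le_self two_ne_zero
    have h1 := len_add_quotient (Ring.jacobson A)
    have h2 := len_add_quotient ((Ring.jacobson A ^ 2).submoduleOf (Ring.jacobson A))
    have h3 : len A (Residue A) = 1 := len_eq_of_length_eq (by simp [Module.length_eq_one])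
    rw [len_congr (Submodule.submoduleOfEquivOfLe hle), len_eq_of_length_eq h.1,
      len_eq_of_length_eq h.2] at h2
    rw [h1, h2, h3]
    ring

theorem op_mem_jacobson_pow {A : Type u} [Ring A] [IsLocalRing A] {n : ℕ} {x : A}
    (hx : x ∈ Ring.jacobson A ^ n) : MulOpposite.op x ∈ Ring.jacobson Aᵐᵒᵖ ^ n := by
  induction n generalizing x with
  | zero => rw [Submodule.pow_zero, Ideal.one_eq_top]; trivial
  | succ n ih =>
    rw [Submodule.pow_succ, ← Ideal.smul_eq_mul] at hx
    rw [Ideal.IsTwoSided.pow_succ]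
    exact Submodule.smul_induction_on hx
      (fun r hr y hy => Ideal.mul_mem_mul (op_mem_jacobson.mpr hy) (ih hr))
      fun x y hx hy => add_mem hx hy

theorem unop_mem_jacobson_pow {A : Type u} [Ring A] [IsLocalRing A] {n : ℕ} {x : Aᵐᵒᵖ}
    (hx : x ∈ Ring.jacobson Aᵐᵒᵖ ^ n) : x.unop ∈ Ring.jacobson A ^ n := by
  induction n generalizing x with
  | zero => rw [Submodule.pow_zero, Ideal.one_eq_top]; trivial
  | succ n ih =>
    rw [Submodule.pow_succ, ← Ideal.smul_eq_mul] at hx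
    rw [Ideal.IsTwoSided.pow_succ]
    exact Submodule.smul_induction_on hx
      (fun r hr y hy => Ideal.mul_mem_mul (op_mem_jacobson.mp hy) (ih hr))
      fun x y hx hy => add_mem hx hy

theorem HasShortType.op (k : Type v) [CommRing k] [IsArtinianRing k] {A : Type u} [Ring A]
    [Algebra k A] [Module.Finite k A] [IsLocalRing A] {e a : ℕ} (h : HasShortType A e a) :
    HasShortType Aᵐᵒᵖ e a where
  short := by
    refine (Submodule.eq_bot_iff _).mpr fun x hx => MulOpposite.unop_injective ?_
    have h1 := unop_mem_jacobson_pow hx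
    rw [show Ring.jacobson A ^ 3 = ⊥ from h.short] at h1
    exact h1
  len_ring := by
    have h1 : len k A = len k Aᵐᵒᵖ := len_congr (MulOpposite.opLinearEquiv k)
    rw [len_base (k := k) (A := A) A, len_base (k := k) (A := Aᵐᵒᵖ) Aᵐᵒᵖ, resLen_op] at h1
    rw [← Nat.eq_of_mul_eq_mul_left resLen_pos h1, h.len_ring]
  len_sq := by
    have : IsArtinianRing A := IsArtinianRing.of_finite k A
    have : IsArtinianRing Aᵐᵒᵖ := IsArtinianRing.of_finite k Aᵐᵒᵖ
    have h1 : len k ↥(Ring.jacobson A ^ 2) = len k ↥(Ring.jacobson Aᵐᵒᵖ ^ 2) := len_congr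
      { toFun := fun x => ⟨MulOpposite.op x.1, op_mem_jacobson_pow x.2⟩
        map_add' := fun _ _ => rfl
        map_smul' := fun _ _ => rfl
        invFun := fun y => ⟨y.1.unop, unop_mem_jacobson_pow y.2⟩
        left_inv := fun _ => rfl
        right_inv := fun _ => rfl }
    rw [len_base (k := k) (A := A) ↥(Ring.jacobson A ^ 2),
      len_base (k := k) (A := Aᵐᵒᵖ) ↥(Ring.jacobson Aᵐᵒᵖ ^ 2), resLen_op] at h1
    rw [← Nat.eq_of_mul_eq_mul_left resLen_pos h1, h.len_sq]

theorem HasShortType.jacobson_mul {A : Type u} [Ring A] {e a : ℕ} (h : HasShortType A e a)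
    {r x : A} (hr : r ∈ Ring.jacobson A) (hx : x ∈ Ring.jacobson A ^ 2) : r * x = 0 := by
  have h1 := Ideal.mul_mem_mul hr hx
  rwa [← Ideal.IsTwoSided.pow_succ, show Ring.jacobson A ^ (2 + 1) = ⊥ from h.short] at h1

theorem HasShortType.len_jacobson {A : Type u} [Ring A] [IsArtinianRing A] [IsLocalRing A]
    {e a : ℕ} (h : HasShortType A e a) : len A (Ring.jacobson A) = e + a := by
  have h1 := len_add_quotient (Ring.jacobson A)
  have h3 : len A (Residue A) = 1 := len_eq_of_length_eq (by simp [Module.length_eq_one])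
  rw [h.len_ring, h3] at h1
  omega

end ShortType

/-! ### Lengths of the top and of the radical -/

section TopRad

variable (A : Type u) [Ring A] (X : Type u) [AddCommGroup X] [Module A X]

/-- The length of `X / J X`. -/
noncomputable def topLen : ℕ := len A (X ⧸ Ring.jacobson A • (⊤ : Submodule A X))

/-- The length of `J X`. -/
noncomputable def radLen : ℕ := len A ↥(Ring.jacobson A • (⊤ : Submodule A X))

variable {A X}

theorem len_eq_radLen_add_topLen [IsArtinianRing A] [Module.Finite A X] :
    len A X = radLen A X + topLen A X :=
  len_add_quotient _

theorem topLen_eq_zero_iff [IsArtinianRing A] [Module.Finite A X] :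
    topLen A X = 0 ↔ Subsingleton X := by
  rw [topLen, len_eq_zero_iff, Submodule.Quotient.subsingleton_iff]
  constructor
  · intro h
    by_contra hX
    rw [not_subsingleton_iff_nontrivial] at hX
    exact (Submodule.jacobson_smul_lt_top (⊤ : Submodule A X)).ne h
  · intro h
    exact Subsingleton.elim _ _

variable {Y : Type u} [AddCommGroup Y] [Module A Y]

theorem len_smul_top_congr (f : X ≃ₗ[A] Y) (I : Ideal A) :
    len A ↥(I • (⊤ : Submodule A X)) = len A ↥(I • (⊤ : Submodule A Y)) := by
  have h : (I • (⊤ : Submodule A X)).map f.toLinearMap = I • (⊤ : Submodule A Y) := by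
    rw [Submodule.map_smul'', Submodule.map_top, LinearEquiv.range]
  rw [len_congr (f.submoduleMap (I • (⊤ : Submodule A X)))]
  exact len_congr (LinearEquiv.ofEq _ _ h)

theorem smul_top_pi (I : Ideal A) [I.IsTwoSided] (t : ℕ) :
    I • (⊤ : Submodule A (Fin t → A)) = Submodule.pi Set.univ fun _ => I := by
  refine le_antisymm (Submodule.smul_le.mpr fun r hr x _ i _ => I.mul_mem_right _ hr) fun x hx => ?_
  rw [pi_eq_sum_univ' x]
  exact Submodule.sum_mem _ fun i _ => Submodule.smul_mem_smul (hx i trivial) trivial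

theorem len_smul_top_free [IsArtinianRing A] {t : ℕ} (f : X ≃ₗ[A] (Fin t → A)) (I : Ideal A)
    [I.IsTwoSided] : len A ↥(I • (⊤ : Submodule A X)) = t * len A I := by
  rw [len_smul_top_congr f, smul_top_pi, ← len_pi]
  exact len_congr
    { toFun := fun x i => ⟨x.1 i, x.2 i trivial⟩
      map_add' := fun _ _ => rfl
      map_smul' := fun _ _ => rfl
      invFun := fun y => ⟨fun i => (y i).1, fun i _ => (y i).2⟩
      left_inv := fun _ => rfl
      right_inv := fun _ => rfl }

variable {k : Type v} [CommRing k] [IsArtinianRing k] [Algebra k A] [Module.Finite k A]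
  [IsLocalRing A]

/-- Maps to a module annihilated by `J` factor through the top. -/
theorem len_hom_of_jacobson_smul [Module.Finite A X] [Module k Y] [IsScalarTower k A Y]
    [SMulCommClass A k Y] [Module.Finite A Y] (hY : ∀ r ∈ Ring.jacobson A, ∀ y : Y, r • y = 0) :
    len k (X →ₗ[A] Y) = resLen k A * (len A Y * topLen A X) := by
  rw [topLen, ← len_hom_semisimple (k := k) (A := A) _ Y jacobson_smul_quotient hY]
  refine (len_congr (LinearEquiv.ofBijective
    (LinearMap.lcomp k Y (Ring.jacobson A • (⊤ : Submodule A X)).mkQ)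
    ⟨LinearMap.lcomp_injective_of_surjective _ (Submodule.mkQ_surjective _), fun f => ?_⟩)).symm
  have hle : Ring.jacobson A • (⊤ : Submodule A X) ≤ LinearMap.ker f :=
    Submodule.smul_le.mpr fun r hr x _ => by
      rw [LinearMap.mem_ker, map_smul, hY r hr]
  exact ⟨(Ring.jacobson A • (⊤ : Submodule A X)).liftQ f hle, Submodule.liftQ_mkQ _ _ hle⟩

end TopRad

/-! ### Minimal covers -/

section Cover

variable {A : Type u} [Ring A]
variable {K F N : Type u} [AddCommGroup K] [Module A K] [AddCommGroup F] [Module A F]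
  [AddCommGroup N] [Module A N]

/-- A short exact sequence `0 → K → F → N → 0` with `F` free of rank `t` and the image of `K`
contained in `J F`. -/
structure IsMinimalCover (t : ℕ) (i : K →ₗ[A] F) (p : F →ₗ[A] N) : Prop where
  injective : Function.Injective i
  surjective : Function.Surjective p
  exact : Function.Exact i p
  free : Nonempty (F ≃ₗ[A] (Fin t → A))
  range_le : LinearMap.range i ≤ Ring.jacobson A • (⊤ : Submodule A F)

theorem jacobson_sq_smul (X : Type u) [AddCommGroup X] [Module A X] :
    Ring.jacobson A ^ 2 • (⊤ : Submodule A X) =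
      Ring.jacobson A • (Ring.jacobson A • (⊤ : Submodule A X)) := by
  rw [← Submodule.mul_smul, Submodule.pow_succ, Submodule.pow_one]

/-- Submodules of `J F` for a module `F` over a short ring have Loewy length at most two. -/
theorem HasShortType.sq_smul_eq_bot {e a : ℕ} (hA : HasShortType A e a) {i : K →ₗ[A] F}
    (hi : Function.Injective i)
    (hle : LinearMap.range i ≤ Ring.jacobson A • (⊤ : Submodule A F)) :
    Ring.jacobson A ^ 2 • (⊤ : Submodule A K) = ⊥ := by
  apply Submodule.map_injective_of_injective hi
  rw [Submodule.map_bot, Submodule.map_smul'', Submodule.map_top, ← le_bot_iff]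
  refine (smul_mono_right _ hle).trans ?_
  rw [← Submodule.mul_smul, ← Submodule.pow_succ, show Ring.jacobson A ^ (2 + 1) = ⊥ from hA.short,
    Submodule.bot_smul]

theorem map_jacobson_smul_le {i : K →ₗ[A] F}
    (hle : LinearMap.range i ≤ Ring.jacobson A • (⊤ : Submodule A F)) :
    (Ring.jacobson A • (⊤ : Submodule A K)).map i ≤ Ring.jacobson A ^ 2 • (⊤ : Submodule A F) := by
  rw [Submodule.map_smul'', Submodule.map_top, jacobson_sq_smul]
  exact smul_mono_right _ hle

namespace IsMinimalCover

variable {t : ℕ} {i : K →ₗ[A] F} {p : F →ₗ[A] N} (h : IsMinimalCover t i p)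
include h

theorem finite_free : Module.Finite A F :=
  have ⟨f⟩ := h.free
  Module.Finite.equiv f.symm

theorem projective : Module.Projective A F :=
  have ⟨f⟩ := h.free
  Module.Projective.of_equiv f.symm

theorem finite_right : Module.Finite A N :=
  have := h.finite_free
  Module.Finite.of_surjective p h.surjective

theorem finite_left [IsArtinianRing A] : Module.Finite A K :=
  have := h.finite_free
  Module.Finite.of_injective i h.injective

theorem extVanishes_left {n : ℕ} (hN : ExtVanishes A N (n + 2)) : ExtVanishes A K (n + 1) :=
  have := h.projective
  (extVanishes_of_projective n).left h.injective h.surjective h.exact hN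

theorem extVanishes_left_of_forall (hN : ∀ n, 1 ≤ n → ExtVanishes A N n) (n : ℕ) (hn : 1 ≤ n) :
    ExtVanishes A K n := by
  obtain ⟨n, rfl⟩ := Nat.exists_eq_add_of_le' hn
  exact h.extVanishes_left (hN _ (by omega))

theorem extVanishes_right {n : ℕ} (hN : ExtVanishes A K (n + 1)) : ExtVanishes A N (n + 2) :=
  have := h.projective
  hN.right h.injective h.surjective h.exact (extVanishes_of_projective (n + 1))

theorem exists_extension (hN : ExtVanishes A N 1) (φ : K →ₗ[A] A) :
    ∃ ψ : F →ₗ[A] A, ψ ∘ₗ i = φ :=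
  hN.exists_extension h.injective h.surjective h.exact φ

theorem sq_smul_le_range (hN : Ring.jacobson A ^ 2 • (⊤ : Submodule A N) = ⊥) :
    Ring.jacobson A ^ 2 • (⊤ : Submodule A F) ≤ LinearMap.range i := by
  rw [← h.exact.linearMap_ker_eq]
  refine Submodule.smul_le.mpr fun r hr x _ => ?_
  rw [LinearMap.mem_ker, map_smul, ← Submodule.mem_bot A, ← hN]
  exact Submodule.smul_mem_smul hr trivial

variable [IsArtinianRing A] {e a : ℕ} (hA : HasShortType A e a)
include hA

theorem len_free : len A F = t * (1 + e + a) := by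
  obtain ⟨f⟩ := h.free
  rw [len_congr f, len_pi, hA.len_ring]

theorem len_add : len A K + len A N = t * (1 + e + a) := by
  have := h.finite_free
  rw [← h.len_free hA, len_add_of_exact h.injective h.surjective h.exact]

theorem len_sq_smul : len A ↥(Ring.jacobson A ^ 2 • (⊤ : Submodule A F)) = t * a := by
  obtain ⟨f⟩ := h.free
  rw [len_smul_top_free f, hA.len_sq]

variable [IsLocalRing A]

theorem topLen_free : topLen A F = t := by
  have := h.finite_free
  obtain ⟨f⟩ := h.free
  have h1 : radLen A F = t * (e + a) := by
    rw [radLen, len_smul_top_free f, hA.len_jacobson]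
  have h2 := len_eq_radLen_add_topLen (A := A) (X := F)
  rw [h1, h.len_free hA, add_assoc, mul_add, mul_one] at h2
  omega

theorem topLen_right : topLen A N = t := by
  have := h.finite_free
  rw [← h.topLen_free hA, topLen, topLen]
  refine (len_congr (LinearEquiv.ofBijective
    (Submodule.mapQ (Ring.jacobson A • (⊤ : Submodule A F)) (Ring.jacobson A • (⊤ : Submodule A N))
      p ?_) ⟨?_, ?_⟩)).symm
  · rw [← Submodule.map_le_iff_le_comap, Submodule.map_smul'']
    exact smul_mono_right _ le_top
  · rw [← LinearMap.ker_eq_bot, Submodule.mapQ, Submodule.ker_liftQ_eq_bot]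
    intro x hx
    rw [LinearMap.mem_ker, LinearMap.comp_apply, Submodule.mkQ_apply,
      Submodule.Quotient.mk_eq_zero, ← LinearMap.range_eq_top.mpr h.surjective,
      ← Submodule.map_top, ← Submodule.map_smul''] at hx
    obtain ⟨y, hy, hxy⟩ := hx
    have h1 : x - y ∈ LinearMap.ker p := by rw [LinearMap.mem_ker, map_sub, hxy, sub_self]
    rw [h.exact.linearMap_ker_eq] at h1
    have := add_mem (h.range_le h1) hy
    rwa [sub_add_cancel] at this
  · intro y
    obtain ⟨y, rfl⟩ := Submodule.Quotient.mk_surjective _ y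
    obtain ⟨x, rfl⟩ := h.surjective y
    exact ⟨Submodule.Quotient.mk x, rfl⟩

/-- If no element of `K` spans a simple direct summand, then `J K = J ^ 2 F`: an element of
`J ^ 2 F` lies in the socle of `K`, hence in `J K`. -/
theorem radLen_left (hinj : ¬ Module.Injective A A)
    (hN : Ring.jacobson A ^ 2 • (⊤ : Submodule A N) = ⊥) {n₀ : ℕ}
    (hK : ∀ n, n₀ ≤ n → ExtVanishes A K n) : radLen A K = a * t := by
  have heq : (Ring.jacobson A • (⊤ : Submodule A K)).map i =
      Ring.jacobson A ^ 2 • (⊤ : Submodule A F) := by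
    refine le_antisymm (map_jacobson_smul_le h.range_le) fun x hx => ?_
    obtain ⟨y, rfl⟩ := h.sq_smul_le_range hN hx
    refine Submodule.mem_map_of_mem (mem_jacobson_smul_of_extVanishes hinj hK fun r hr => ?_)
    apply h.injective
    rw [map_smul, map_zero, ← Submodule.mem_bot A]
    have h3 : Ring.jacobson A • (Ring.jacobson A ^ 2 • (⊤ : Submodule A F)) = ⊥ := by
      rw [← Submodule.mul_smul, ← Ideal.IsTwoSided.pow_succ,
        show Ring.jacobson A ^ (2 + 1) = ⊥ from hA.short, Submodule.bot_smul]
    rw [← h3]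
    exact Submodule.smul_mem_smul hr hx
  rw [mul_comm, ← h.len_sq_smul hA, ← heq, radLen]
  exact len_congr (Submodule.equivMapOfInjective i h.injective _)

/-- If `J ^ 2` is simple and `A` is not self-injective, then the socle of `A` contains an element
`x` outside `J ^ 2`. If `K ≠ 0`, a map from `K` onto `A x` would extend to `ψ : F → A`. If `ψ` is onto,
then `J ^ 2 = ψ (J ^ 2 F) ⊆ ψ (K) = A x`, so `A x = J ^ 2`; otherwise
`A x = ψ (K) ⊆ J ψ (F) ⊆ J ^ 2`. Both are impossible. -/
theorem subsingleton_left (k : Type v) [CommRing k] [IsArtinianRing k] [Algebra k A]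
    [Module.Finite k A] (hinj : ¬ Module.Injective A A) (ha : a = 1)
    (hN : Ring.jacobson A ^ 2 • (⊤ : Submodule A N) = ⊥) (hExt : ExtVanishes A N 1) :
    Subsingleton K := by
  by_contra hK
  rw [not_subsingleton_iff_nontrivial] at hK
  have := h.finite_left
  obtain ⟨f, hf⟩ := exists_surjective_residue (A := A) (X := K)
  have hsoc : ∀ x : A, (∀ r ∈ Ring.jacobson A, r • x = 0) → x ∈ Ring.jacobson A ^ 2 := by
    intro x hx
    by_contra hxJ
    have hx0 : x ≠ 0 := fun h0 => hxJ (h0 ▸ zero_mem _)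
    obtain ⟨ψ, hψ⟩ := h.exists_extension hExt (residueMap x hx ∘ₗ f)
    have hψi : (LinearMap.range i).map ψ = LinearMap.range (residueMap x hx) := by
      rw [← LinearMap.range_comp, hψ, LinearMap.range_comp_of_range_eq_top _
        (LinearMap.range_eq_top.mpr hf)]
    have hxmem : x ∈ LinearMap.range (residueMap x hx) :=
      ⟨Submodule.Quotient.mk 1, (residueMap_mk x hx 1).trans (one_smul A x)⟩
    by_cases htop : LinearMap.range ψ = ⊤
    · have hle : Ring.jacobson A ^ 2 ≤ LinearMap.range (residueMap x hx) := by
        rw [← hψi]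
        refine le_trans ?_ (Submodule.map_mono (h.sq_smul_le_range hN))
        rw [Submodule.map_smul'', Submodule.map_top, htop, Ideal.smul_eq_mul, Ideal.mul_top]
      have hlen : len A (LinearMap.range (residueMap x hx)) = 1 := by
        rw [← len_congr (LinearEquiv.ofInjective _ (residueMap_injective hx hx0))]
        exact len_eq_of_length_eq (by simp [Module.length_eq_one])
      rw [← eq_of_le_of_len_le hle (by rw [hlen, hA.len_sq, ha])] at hxmem
      exact hxJ hxmem
    · rw [← hψi] at hxmem
      have h1 : (LinearMap.range i).map ψ ≤ Ring.jacobson A ^ 2 := by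
        refine (Submodule.map_mono h.range_le).trans ?_
        rw [Submodule.map_smul'', Submodule.map_top, Submodule.pow_succ, Submodule.pow_one]
        exact smul_mono_right _ (le_jacobson_of_ne_top htop)
      exact hxJ (h1 hxmem)
  refine hinj (injective_of_len_hom_residue_le (k := k) ?_)
  have h1 := len_base (k := k) (A := A) ↥(Ring.jacobson A ^ 2)
  rw [hA.len_sq, ha, mul_one] at h1
  rw [← h1]
  have := finite_of_tower k (A := A) ↥(Ring.jacobson A ^ 2)
  refine len_le_of_injective
    { toFun := fun f => ⟨f (Submodule.Quotient.mk 1), hsoc _ fun r hr => ?_⟩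
      map_add' := fun _ _ => rfl
      map_smul' := fun _ _ => rfl } ?_
  · rw [← map_smul, ← Submodule.Quotient.mk_smul, smul_eq_mul, mul_one,
      (Submodule.Quotient.mk_eq_zero _).mpr hr, map_zero]
  · intro f g hfg
    exact Submodule.linearMap_qext _ (LinearMap.ext_ring (congrArg Subtype.val hfg))

/-- If `|J ^ 2| ≥ 2`, then a map `F → A` which sends `K` into `J ^ 2` has image in `J`. If it were
surjective, it would map `K` onto `J ^ 2`; its restriction to `K` is a sum of two maps with smaller
image, these extend to non-surjective maps `F → A`, and the difference vanishes on `J ^ 2 F`. -/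
theorem range_le_jacobson (ha : 2 ≤ a) (hN : Ring.jacobson A ^ 2 • (⊤ : Submodule A N) = ⊥)
    (hExt : ExtVanishes A N 1) (ψ : F →ₗ[A] A) (hψ : ∀ x, ψ (i x) ∈ Ring.jacobson A ^ 2) :
    LinearMap.range ψ ≤ Ring.jacobson A := by
  -- the image of a map with `f (K) ⊉ J ^ 2` lies in `J`
  have key : ∀ f : F →ₗ[A] A, ¬ Ring.jacobson A ^ 2 ≤ LinearMap.range (f ∘ₗ i) →
      LinearMap.range f ≤ Ring.jacobson A := by
    refine fun f hf => le_jacobson_of_ne_top fun htop => hf ?_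
    rw [LinearMap.range_comp]
    refine le_trans ?_ (Submodule.map_mono (h.sq_smul_le_range hN))
    rw [Submodule.map_smul'', Submodule.map_top, htop, Ideal.smul_eq_mul, Ideal.mul_top]
  have hss : IsSemisimpleModule A ↥(Ring.jacobson A ^ 2) :=
    isSemisimpleModule_of_jacobson_smul fun r hr x => Subtype.ext (hA.jacobson_mul hr x.2)
  have hlen := hA.len_sq
  obtain ⟨y, hy0⟩ : ∃ y : ↥(Ring.jacobson A ^ 2), y ≠ 0 := by
    by_contra! hall
    have : Subsingleton ↥(Ring.jacobson A ^ 2) := ⟨fun x y => (hall x).trans (hall y).symm⟩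
    rw [len_eq_zero_iff.mpr this] at hlen
    omega
  have hyJ : ∀ r ∈ Ring.jacobson A, r • y = 0 := fun r hr => Subtype.ext (hA.jacobson_mul hr y.2)
  -- `π` projects `J ^ 2` onto the simple submodule spanned by `y`
  obtain ⟨q, hq⟩ := IsSemisimpleModule.extension_property _ (residueMap_injective hyJ hy0)
    LinearMap.id
  let π : ↥(Ring.jacobson A ^ 2) →ₗ[A] ↥(Ring.jacobson A ^ 2) := residueMap y hyJ ∘ₗ q
  have hπy : π y = y := by
    have h1 := LinearMap.congr_fun hq (Submodule.Quotient.mk 1)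
    have h2 : residueMap y hyJ (Submodule.Quotient.mk 1) = y :=
      (residueMap_mk y hyJ 1).trans (one_smul A y)
    change residueMap y hyJ (q y) = y
    rw [LinearMap.comp_apply, h2] at h1
    rw [h1, LinearMap.id_apply, h2]
  have hπ : LinearMap.range π ≠ ⊤ := by
    intro htop
    have h1 : len A (Residue A) = 1 := len_eq_of_length_eq (by simp [Module.length_eq_one])
    have h2 := len_range_add_ker (residueMap y hyJ)
    have h3 : LinearMap.range (residueMap y hyJ) = ⊤ :=
      top_le_iff.mp (htop ▸ LinearMap.range_comp_le_range _ _)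
    rw [h1, h3, len_top, hlen] at h2
    omega
  let σ : ↥(Ring.jacobson A ^ 2) →ₗ[A] ↥(Ring.jacobson A ^ 2) := LinearMap.id - π
  have hπ' : LinearMap.range σ ≠ ⊤ := by
    intro htop
    have hinj : Function.Injective σ := by
      rw [← LinearMap.ker_eq_bot]
      have h2 := len_range_add_ker σ
      rw [htop, len_top] at h2
      have h3 : len A (LinearMap.ker σ) = 0 := by omega
      rw [len_eq_zero_iff] at h3
      exact Submodule.subsingleton_iff_eq_bot.mp h3
    refine hy0 (hinj ?_)
    rw [map_zero]
    change y - π y = 0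
    rw [hπy, sub_self]
  let ρ : K →ₗ[A] ↥(Ring.jacobson A ^ 2) := (ψ ∘ₗ i).codRestrict _ hψ
  have hsub : ∀ θ : ↥(Ring.jacobson A ^ 2) →ₗ[A] ↥(Ring.jacobson A ^ 2),
      LinearMap.range θ ≠ ⊤ → ∃ f : F →ₗ[A] A,
        LinearMap.range f ≤ Ring.jacobson A ∧ ∀ x, f (i x) = (θ (ρ x)).1 := by
    intro θ hθ
    obtain ⟨f, hf⟩ := h.exists_extension hExt ((Ring.jacobson A ^ 2).subtype ∘ₗ θ ∘ₗ ρ)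
    refine ⟨f, key f fun hle => hθ (top_le_iff.mp fun z _ => ?_), LinearMap.congr_fun hf⟩
    rw [hf] at hle
    obtain ⟨x, hx⟩ := hle z.2
    exact ⟨ρ x, Subtype.ext hx⟩
  obtain ⟨f, hfJ, hf⟩ := hsub π hπ
  obtain ⟨g, hgJ, hg⟩ := hsub _ hπ'
  have hdiff : LinearMap.range (ψ - f - g) ≤ Ring.jacobson A := by
    refine key _ fun hle => hy0 (Subtype.ext ?_)
    obtain ⟨x, hx⟩ := hle y.2
    rw [← hx]
    change ψ (i x) - f (i x) - g (i x) = 0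
    rw [hf, hg]
    change ψ (i x) - (π (ρ x)).1 - (ψ (i x) - (π (ρ x)).1) = 0
    abel
  rintro _ ⟨x, rfl⟩
  have h1 : ψ x = (ψ - f - g) x + f x + g x := by
    simp only [LinearMap.sub_apply]; abel
  rw [h1]
  exact add_mem (add_mem (hdiff ⟨x, rfl⟩) (hfJ ⟨x, rfl⟩)) (hgJ ⟨x, rfl⟩)

end IsMinimalCover

end Cover

/-! ### Duals of minimal covers and the recursion for the ranks -/

section PostComp

variable (k : Type v) [CommRing k] {A : Type u} [Ring A] [Algebra k A]
  (X : Type u) {Y Z : Type u} [AddCommGroup X] [Module A X] [AddCommGroup Y] [Module A Y]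
  [AddCommGroup Z] [Module A Z] [Module k Y] [IsScalarTower k A Y] [SMulCommClass A k Y]
  [Module k Z] [IsScalarTower k A Z] [SMulCommClass A k Z]

/-- Composition with an `A`-linear map, as a `k`-linear map of `Hom`-modules. -/
def postComp (g : Y →ₗ[A] Z) : (X →ₗ[A] Y) →ₗ[k] (X →ₗ[A] Z) where
  toFun f := g ∘ₗ f
  map_add' f f' := LinearMap.comp_add f f' g
  map_smul' c f := LinearMap.ext fun x => LinearMap.map_smul_of_tower g c (f x)

theorem mem_ker_postComp_mkQ {k : Type v} [CommRing k] {A : Type u} [Ring A] [Algebra k A]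
    {X : Type u} [AddCommGroup X] [Module A X] {I : Ideal A} {f : X →ₗ[A] A} :
    f ∈ LinearMap.ker (postComp k X I.mkQ) ↔ ∀ x, f x ∈ I := by
  rw [LinearMap.mem_ker, LinearMap.ext_iff]
  exact forall_congr' fun x => Submodule.Quotient.mk_eq_zero I

end PostComp

namespace IsMinimalCover

variable {k : Type v} [CommRing k] [IsArtinianRing k]
  {A : Type u} [Ring A] [Algebra k A] [Module.Finite k A] [IsLocalRing A]
  {K F N : Type u} [AddCommGroup K] [Module A K] [AddCommGroup F] [Module A F]
  [AddCommGroup N] [Module A N] {t : ℕ} {i : K →ₗ[A] F} {p : F →ₗ[A] N}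
  (h : IsMinimalCover t i p) {e a : ℕ} (hA : HasShortType A e a)
include h hA

theorem len_hom_add (hExt : ExtVanishes A N 1) :
    len k (K →ₗ[A] A) + len k (N →ₗ[A] A) = resLen k A * (t * (1 + e + a)) := by
  have : IsArtinianRing A := IsArtinianRing.of_finite k A
  have := h.finite_free
  obtain ⟨f⟩ := h.free
  rw [← len_hom_eq_of_exact h.surjective h.exact (h.exists_extension hExt),
    len_congr (LinearEquiv.congrLeft A k f),
    ← len_congr (LinearMap.lsum A (fun _ : Fin t => A) k (M := A))]
  have := finite_hom k A A A
  rw [len_pi, len_hom_self, len_base (k := k) (A := A) A, hA.len_ring]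
  ring

/-- The dual of `K` has the submodule `Hom (K, J ^ 2)` with quotient
`Hom (F, A) / Hom (F, J) = Hom (F, A / J)`. -/
theorem len_hom_left (ha : 2 ≤ a) (hN : Ring.jacobson A ^ 2 • (⊤ : Submodule A N) = ⊥)
    (hExt : ExtVanishes A N 1) :
    len k (K →ₗ[A] A) = resLen k A * (a * topLen A K + t) := by
  have : IsArtinianRing A := IsArtinianRing.of_finite k A
  have := h.finite_free
  have := h.finite_left
  have := h.projective
  have := finite_hom k A K A
  have := finite_hom k A F A
  let Φ := postComp k K (Ring.jacobson A ^ 2).mkQ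
  let Ψ := postComp k F (Ring.jacobson A).mkQ
  let R : (F →ₗ[A] A) →ₗ[k] (K →ₗ[A] A) := LinearMap.lcomp k A i
  have hR : LinearMap.range R = ⊤ := LinearMap.range_eq_top.mpr (h.exists_extension hExt)
  have hker : LinearMap.ker (Φ ∘ₗ R) = LinearMap.ker Ψ := by
    ext f
    have h1 : f ∈ LinearMap.ker (Φ ∘ₗ R) ↔ f ∘ₗ i ∈ LinearMap.ker Φ := Iff.rfl
    rw [h1, mem_ker_postComp_mkQ, mem_ker_postComp_mkQ]
    constructor
    · intro hf x
      exact h.range_le_jacobson hA ha hN hExt f hf ⟨x, rfl⟩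
    · intro hf x
      have h3 := Submodule.mem_map_of_mem (f := f) (h.range_le ⟨x, rfl⟩)
      rw [Submodule.map_smul'', Submodule.map_top] at h3
      rw [Submodule.pow_succ, Submodule.pow_one, ← Ideal.smul_eq_mul]
      have hle : LinearMap.range f ≤ Ring.jacobson A := by
        rintro _ ⟨y, rfl⟩
        exact hf y
      exact (smul_mono_right (Ring.jacobson A) hle : _ ≤ _) h3
  have hΨ : LinearMap.range Ψ = ⊤ := LinearMap.range_eq_top.mpr fun f => by
    obtain ⟨g, hg⟩ := Module.projective_lifting_property (Ring.jacobson A).mkQ f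
      (Submodule.mkQ_surjective _)
    exact ⟨g, hg⟩
  have h1 : len k (LinearMap.range Φ) = resLen k A * t := by
    rw [← LinearMap.range_comp_of_range_eq_top Φ hR]
    have h2 := len_range_add_ker (Φ ∘ₗ R)
    have h3 := len_range_add_ker Ψ
    have h4 : len A (Residue A) = 1 := len_eq_of_length_eq (by simp [Module.length_eq_one])
    have h5 : len k (F →ₗ[A] Residue A) = resLen k A * (len A (Residue A) * topLen A F) :=
      len_hom_of_jacobson_smul fun r hr x => by
        obtain ⟨x, rfl⟩ := Submodule.Quotient.mk_surjective _ x
        exact (Submodule.Quotient.mk_eq_zero _).mpr (Ideal.mul_mem_right _ _ hr)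
    rw [hΨ, len_top, h5, h4, one_mul, h.topLen_free hA] at h3
    rw [hker] at h2
    omega
  have h2 : len k (LinearMap.ker Φ) = resLen k A * (a * topLen A K) := by
    rw [← hA.len_sq, ← len_hom_of_jacobson_smul (k := k) (A := A) (X := K)
      (Y := ↥(Ring.jacobson A ^ 2)) fun r hr x => Subtype.ext (hA.jacobson_mul hr x.2)]
    exact len_congr
      { toFun := fun f => f.1.codRestrict _ ((mem_ker_postComp_mkQ.mp f.2))
        map_add' := fun _ _ => rfl
        map_smul' := fun _ _ => rfl
        invFun := fun g => ⟨(Ring.jacobson A ^ 2).subtype ∘ₗ g,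
          mem_ker_postComp_mkQ.mpr fun x => (g x).2⟩
        left_inv := fun _ => rfl
        right_inv := fun _ => rfl }
  rw [len_range_add_ker Φ, h1, h2, mul_add]

end IsMinimalCover

section Recursion

variable {A : Type u} [Ring A] [IsLocalRing A] {N F₀ F₁ K₁ K₂ : Type u}
  [AddCommGroup N] [Module A N] [AddCommGroup F₀] [Module A F₀] [AddCommGroup F₁] [Module A F₁]
  [AddCommGroup K₁] [Module A K₁] [AddCommGroup K₂] [Module A K₂] {t₀ t₁ e a n₀ : ℕ}
  {i₀ : K₁ →ₗ[A] F₀} {p₀ : F₀ →ₗ[A] N} {i₁ : K₂ →ₗ[A] F₁} {p₁ : F₁ →ₗ[A] K₁}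

/-- The recursion for the ranks coming from `J K = J ^ 2 F` for the two covers. -/
theorem rank_recursion [IsArtinianRing A] (hA : HasShortType A e a)
    (hinj : ¬ Module.Injective A A)
    (h₀ : IsMinimalCover t₀ i₀ p₀) (h₁ : IsMinimalCover t₁ i₁ p₁)
    (hN : Ring.jacobson A ^ 2 • (⊤ : Submodule A N) = ⊥)
    (hK₁ : ∀ n, n₀ ≤ n → ExtVanishes A K₁ n) (hK₂ : ∀ n, n₀ ≤ n → ExtVanishes A K₂ n) :
    topLen A K₂ + a * t₀ = e * t₁ := by
  have := h₀.finite_left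
  have := h₁.finite_left
  have h1 := len_eq_radLen_add_topLen (A := A) (X := K₁)
  have h2 := len_eq_radLen_add_topLen (A := A) (X := K₂)
  have h3 := h₁.len_add hA
  rw [h₀.radLen_left hA hinj hN hK₁, h₁.topLen_right hA] at h1
  rw [h₁.radLen_left hA hinj (hA.sq_smul_eq_bot h₀.injective h₀.range_le) hK₂] at h2
  rw [h1, h2] at h3
  linarith

/-- If `J ^ 2 = 0`, a submodule of the radical of a free module is semisimple; it is zero if `A` is
not self-injective and the module has eventually vanishing `Ext` into `A`. -/
theorem subsingleton_of_len_sq_eq_zero [IsArtinianRing A] (hA : HasShortType A e 0)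
    (hinj : ¬ Module.Injective A A) {j : N →ₗ[A] F₀} (hj : Function.Injective j)
    (hjJ : LinearMap.range j ≤ Ring.jacobson A • (⊤ : Submodule A F₀))
    (hN : ∀ n, n₀ ≤ n → ExtVanishes A N n) : Subsingleton N := by
  have hbot : Ring.jacobson A ^ 2 = ⊥ := by
    have := hA.len_sq
    rw [len_eq_zero_iff] at this
    exact Submodule.subsingleton_iff_eq_bot.mp this
  have hrad : (Ring.jacobson A • (⊤ : Submodule A N)) = ⊥ := by
    apply Submodule.map_injective_of_injective hj
    rw [Submodule.map_bot, ← le_bot_iff]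
    refine (map_jacobson_smul_le hjJ).trans ?_
    rw [hbot, Submodule.bot_smul]
  have key : ∀ x : N, x = 0 := fun x => by
    have hx := mem_jacobson_smul_of_extVanishes hinj hN (x := x) fun r hr => by
      rw [← Submodule.mem_bot A, ← hrad]
      exact Submodule.smul_mem_smul hr trivial
    rwa [hrad, Submodule.mem_bot] at hx
  exact ⟨fun x y => by rw [key x, key y]⟩

/-- Let `N` be a submodule of the radical of a free module with `Ext^i(N, A) = 0` for all `i ≥ 1`.
If `|J ^ 2| ≥ 2`, comparing the recursion `t₂ + a t₀ = e t₁` for the ranks of the minimal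
resolution with the dual recursion `a t₂ + t₀ = e t₁` shows that the ranks are constant. If
`|J ^ 2| ≤ 1`, then `N = 0`. -/
theorem ranks_eq (k : Type v) [CommRing k] [IsArtinianRing k]
    {A : Type u} [Ring A] [Algebra k A] [Module.Finite k A] [IsLocalRing A]
    {N F F₀ F₁ F₂ K₁ K₂ K₃ : Type u}
    [AddCommGroup N] [Module A N] [AddCommGroup F] [Module A F] [AddCommGroup F₀] [Module A F₀]
    [AddCommGroup F₁] [Module A F₁]
    [AddCommGroup F₂] [Module A F₂] [AddCommGroup K₁] [Module A K₁] [AddCommGroup K₂] [Module A K₂]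
    [AddCommGroup K₃] [Module A K₃]
    {t₀ t₁ t₂ e a : ℕ} {j : N →ₗ[A] F}
    {i₀ : K₁ →ₗ[A] F₀} {p₀ : F₀ →ₗ[A] N} {i₁ : K₂ →ₗ[A] F₁} {p₁ : F₁ →ₗ[A] K₁}
    {i₂ : K₃ →ₗ[A] F₂} {p₂ : F₂ →ₗ[A] K₂} (hA : HasShortType A e a)
    (hinj : ¬ Module.Injective A A) (hj : Function.Injective j)
    (hjJ : LinearMap.range j ≤ Ring.jacobson A • (⊤ : Submodule A F))
    (h₀ : IsMinimalCover t₀ i₀ p₀) (h₁ : IsMinimalCover t₁ i₁ p₁) (h₂ : IsMinimalCover t₂ i₂ p₂)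
    (hN : ∀ n, 1 ≤ n → ExtVanishes A N n) :
    t₁ = t₀ ∧ t₂ = t₀ ∧ e * t₀ = (1 + a) * t₀ ∧
      len k (K₁ →ₗ[A] A) = resLen k A * ((1 + a) * t₀) := by
  have : IsArtinianRing A := IsArtinianRing.of_finite k A
  have := h₀.finite_right
  have := h₀.finite_left
  have := h₁.finite_left
  have := h₂.finite_left
  have hN2 := hA.sq_smul_eq_bot hj hjJ
  have hK₁2 := hA.sq_smul_eq_bot h₀.injective h₀.range_le
  have hK₂2 := hA.sq_smul_eq_bot h₁.injective h₁.range_le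
  have hK₁ := h₀.extVanishes_left_of_forall hN
  have hK₂ := h₁.extVanishes_left_of_forall hK₁
  have hK₃ := h₂.extVanishes_left_of_forall hK₂
  have htop₀ := h₀.topLen_right hA
  have htop₁ := h₁.topLen_right hA
  have htop₂ := h₂.topLen_right hA
  rcases Nat.lt_or_ge a 2 with ha | ha
  · -- in this case `N = 0`
    have ht₀ : t₀ = 0 := by
      obtain rfl | rfl : a = 0 ∨ a = 1 := by omega
      · rw [← htop₀, topLen_eq_zero_iff]
        exact subsingleton_of_len_sq_eq_zero hA hinj hj hjJ hN
      · have hK := h₀.subsingleton_left hA k hinj rfl hN2 (hN 1 le_rfl)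
        have h1 := h₀.len_sq_smul hA
        have h2 : Subsingleton ↥(Ring.jacobson A ^ 2 • (⊤ : Submodule A F₀)) := by
          rw [Submodule.subsingleton_iff_eq_bot, ← le_bot_iff]
          refine (h₀.sq_smul_le_range hN2).trans ?_
          rw [le_bot_iff, LinearMap.range_eq_bot]
          exact Subsingleton.elim _ _
        have := h₀.finite_free
        rw [len_eq_zero_iff.mpr h2] at h1
        omega
    have hzero : ∀ {t : ℕ} {X Y Z : Type u} [AddCommGroup X] [Module A X] [AddCommGroup Y]
        [Module A Y] [AddCommGroup Z] [Module A Z] {i : X →ₗ[A] Y} {p : Y →ₗ[A] Z},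
        IsMinimalCover t i p → t = 0 → Subsingleton X := by
      intro t X Y Z _ _ _ _ _ _ i p h ht
      have := h.finite_left
      have h1 := h.len_add hA
      rw [ht, zero_mul] at h1
      exact (len_eq_zero_iff (R := A)).mp (by omega)
    have hs₁ := hzero h₀ ht₀
    have ht₁ : t₁ = 0 := by rw [← htop₁, topLen_eq_zero_iff]; exact hs₁
    have hs₂ := hzero h₁ ht₁
    have ht₂ : t₂ = 0 := by rw [← htop₂, topLen_eq_zero_iff]; exact hs₂
    have := finite_hom k A K₁ A
    have hhom : len k (K₁ →ₗ[A] A) = 0 := by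
      rw [len_eq_zero_iff]
      exact ⟨fun f g => LinearMap.ext fun x => by rw [Subsingleton.elim x 0, map_zero, map_zero]⟩
    rw [hhom]
    simp [ht₀, ht₁, ht₂]
  · have r1 := rank_recursion hA hinj h₀ h₁ hN2 hK₁ hK₂
    have r2 := rank_recursion hA hinj h₁ h₂ hK₁2 hK₂ hK₃
    have d0 := h₀.len_hom_left (k := k) hA ha hN2 (hN 1 le_rfl)
    have d1 := h₁.len_hom_left (k := k) hA ha hK₁2 (hK₁ 1 le_rfl)
    have d2 := h₂.len_hom_left (k := k) hA ha hK₂2 (hK₂ 1 le_rfl)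
    have s1 := h₁.len_hom_add (k := k) hA (hK₁ 1 le_rfl)
    have s2 := h₂.len_hom_add (k := k) hA (hK₂ 1 le_rfl)
    rw [d0, d1, ← mul_add] at s1
    rw [d1, d2, ← mul_add] at s2
    have q1 := Nat.eq_of_mul_eq_mul_left resLen_pos s1
    have q2 := Nat.eq_of_mul_eq_mul_left resLen_pos s2
    rw [htop₁, htop₂] at q1
    rw [htop₂] at q2
    rw [htop₂] at r1
    rw [d0, htop₁]
    obtain ⟨b, rfl⟩ := Nat.exists_eq_add_of_le ha
    have u : t₂ = t₀ := by
      have : (b + 1) * t₂ = (b + 1) * t₀ := by linarith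
      exact Nat.eq_of_mul_eq_mul_left (Nat.succ_pos b) this
    subst u
    have v : topLen A K₃ = t₁ := by
      have : (b + 1) * topLen A K₃ = (b + 1) * t₁ := by linarith
      exact Nat.eq_of_mul_eq_mul_left (Nat.succ_pos b) this
    rw [v] at r2
    have w : t₁ = t₂ := by
      have : (1 + (2 + b) + e) * t₁ = (1 + (2 + b) + e) * t₂ := by linarith
      exact Nat.eq_of_mul_eq_mul_left (by omega) this
    subst w
    refine ⟨rfl, rfl, by linarith, ?_⟩
    ring

end Recursion

/-! ### Existence of minimal covers -/

section Existence

variable {A : Type u} [Ring A] [IsArtinianRing A] [IsLocalRing A]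
  (N : Type u) [AddCommGroup N] [Module A N] [Module.Finite A N]

/-- The projective cover of a finitely generated module. -/
theorem exists_isMinimalCover : ∃ p : (Fin (topLen A N) → A) →ₗ[A] N,
    IsMinimalCover (topLen A N) (LinearMap.ker p).subtype p := by
  let JN := Ring.jacobson A • (⊤ : Submodule A N)
  obtain ⟨f⟩ := exists_equiv_pi_residue (A := A) (X := N ⧸ JN)
  let q : (Fin (topLen A N) → A) →ₗ[A] (Fin (topLen A N) → Residue A) :=
    LinearMap.pi fun i => (Ring.jacobson A).mkQ ∘ₗ LinearMap.proj i
  obtain ⟨p, hp⟩ := Module.projective_lifting_property JN.mkQ (f.symm.toLinearMap ∘ₗ q)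
    JN.mkQ_surjective
  refine ⟨p, Submodule.injective_subtype _, ?_, LinearMap.exact_subtype_ker_map p,
    ⟨LinearEquiv.refl _ _⟩, ?_⟩
  · have hq : Function.Surjective q := fun y => by
      choose x hx using fun i => (Ring.jacobson A).mkQ_surjective (y i)
      exact ⟨x, funext hx⟩
    have hsurj : Function.Surjective (JN.mkQ ∘ₗ p) := by
      rw [hp]
      exact f.symm.surjective.comp hq
    have hbot : (⊤ : Submodule A (N ⧸ LinearMap.range p)) = ⊥ := by
      refine (Module.Finite.fg_top).eq_bot_of_le_jacobson_smul fun y _ => ?_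
      obtain ⟨y, rfl⟩ := Submodule.Quotient.mk_surjective _ y
      obtain ⟨x, hx⟩ := hsurj (JN.mkQ y)
      have h1 : y - p x ∈ JN := (Submodule.Quotient.eq JN).mp hx.symm
      have h2 := Submodule.mem_map_of_mem (f := (LinearMap.range p).mkQ) h1
      rw [Submodule.map_smul'', map_sub] at h2
      have h3 : (LinearMap.range p).mkQ (p x) = 0 := (Submodule.Quotient.mk_eq_zero _).mpr ⟨x, rfl⟩
      rw [h3, sub_zero] at h2
      exact (smul_mono_right (Ring.jacobson A) le_top :
        _ ≤ Ring.jacobson A • (⊤ : Submodule A (N ⧸ LinearMap.range p))) h2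
    rw [← LinearMap.range_eq_top, ← Submodule.Quotient.subsingleton_iff,
      ← Submodule.subsingleton_iff A]
    exact subsingleton_of_bot_eq_top hbot.symm
  · rw [Submodule.range_subtype, smul_top_pi]
    intro x hx i _
    have h1 : f.symm (q x) = 0 := by
      have := LinearMap.congr_fun hp x
      rw [LinearMap.comp_apply, LinearMap.mem_ker.mp hx, map_zero] at this
      exact this.symm
    have h2 : q x = 0 := f.symm.map_eq_zero_iff.mp h1
    exact (Submodule.Quotient.mk_eq_zero _).mp (congrFun h2 i)

/-- A finitely generated projective module over a local artinian ring is free. -/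
theorem exists_equiv_free_of_projective [Module.Projective A N] :
    Nonempty (N ≃ₗ[A] (Fin (topLen A N) → A)) := by
  obtain ⟨p, hp⟩ := exists_isMinimalCover (A := A) N
  obtain ⟨s, hs⟩ := Module.projective_lifting_property p LinearMap.id hp.surjective
  have hps : ∀ x, p (s x) = x := LinearMap.congr_fun hs
  have hker : LinearMap.ker p = ⊥ := by
    refine (IsNoetherian.noetherian (LinearMap.ker p)).eq_bot_of_le_jacobson_smul fun x hx => ?_
    let r : (Fin (topLen A N) → A) →ₗ[A] (Fin (topLen A N) → A) := LinearMap.id - s ∘ₗ p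
    have hr : r x = x := by
      change x - s (p x) = x
      rw [LinearMap.mem_ker.mp hx, map_zero, sub_zero]
    have hrange : LinearMap.range r ≤ LinearMap.ker p := by
      rintro _ ⟨y, rfl⟩
      change p (y - s (p y)) = 0
      rw [map_sub, hps, sub_self]
    have h1 := hp.range_le
    rw [Submodule.range_subtype] at h1
    have h2 := Submodule.mem_map_of_mem (f := r) (h1 hx)
    rw [hr, Submodule.map_smul'', Submodule.map_top] at h2
    exact (smul_mono_right (Ring.jacobson A) hrange : _ ≤ _) h2
  exact ⟨(LinearEquiv.ofBijective p ⟨LinearMap.ker_eq_bot.mp hker, hp.surjective⟩).symm⟩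

end Existence

/-! ### Minimal acyclic complexes -/

section Complex

variable {A : Type u} [Ring A] (Q : ChainComplex (ModuleCat.{u} A) ℤ)

theorem exact_of_acyclic (hQ : Q.Acyclic) (i : ℤ) :
    Function.Exact (Q.d (i + 1) i).hom (Q.d i (i - 1)).hom := by
  have h := (Q.exactAt_iff' (i + 1) i (i - 1) (ComplexShape.prev_eq' _ rfl)
    (ComplexShape.next_eq' _ (sub_add_cancel i 1))).mp (hQ i)
  exact (ShortComplex.ShortExact.moduleCat_exact_iff_function_exact _).mp h

theorem nonempty_range_equiv (i : ℤ) {j j' : ℤ} (h : j = j') :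
    Nonempty (LinearMap.range (Q.d i j).hom ≃ₗ[A] LinearMap.range (Q.d i j').hom) := by
  subst h
  exact ⟨LinearEquiv.refl _ _⟩

variable [IsArtinianRing A] [IsLocalRing A]

/-- The sequence `0 → N_{i+1} → Q_i → N_i → 0` of a minimal acyclic complex. The proof transports
`N_{i+1}`, a submodule of `Q_{(i+1)-1}`, to `Q_i`. -/
theorem exists_isMinimalCover_imageAt (hproj : IsProjectiveComplex Q) (hmin : IsMinimalComplex Q)
    (hQ : Q.Acyclic) (i : ℤ) :
    ∃ (ι : imageAt Q (i + 1) →ₗ[A] Q.X i) (p : Q.X i →ₗ[A] imageAt Q i),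
      IsMinimalCover (topLen A (Q.X i)) ι p := by
  obtain ⟨f⟩ := nonempty_range_equiv Q (i + 1) (add_sub_cancel_right i 1)
  have h1 := (hproj i).1
  have h2 := (hproj i).2
  have hrange : LinearMap.range ((LinearMap.range (Q.d (i + 1) i).hom).subtype ∘ₗ f.toLinearMap) =
      LinearMap.range (Q.d (i + 1) i).hom := by
    rw [LinearMap.range_comp_of_range_eq_top _ f.range, Submodule.range_subtype]
  refine ⟨(LinearMap.range (Q.d (i + 1) i).hom).subtype ∘ₗ f.toLinearMap,
    (Q.d i (i - 1)).hom.rangeRestrict,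
    (Submodule.injective_subtype _).comp f.injective,
    LinearMap.surjective_rangeRestrict _, ?_, exists_equiv_free_of_projective _, ?_⟩
  · rw [LinearMap.exact_iff, hrange, LinearMap.ker_rangeRestrict]
    exact (exact_of_acyclic Q hQ i).linearMap_ker_eq
  · rw [hrange, ← module_jacobson_eq]
    have := hmin (i + 1)
    rwa [add_sub_cancel_right] at this

/-- By dimension shifting, all images have eventually vanishing `Ext` into `A` if one has. -/
theorem eventually_extVanishes_imageAt (hproj : IsProjectiveComplex Q) (hmin : IsMinimalComplex Q)
    (hQ : Q.Acyclic) {m : ℤ} (hm : ∀ n, 1 ≤ n → ExtVanishes A (imageAt Q m) n) (i : ℤ) :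
    ∃ n₀, ∀ n, n₀ ≤ n → ExtVanishes A (imageAt Q i) n := by
  induction i using Int.inductionOn' (b := m) with
  | zero => exact ⟨1, hm⟩
  | succ i _ ih =>
    obtain ⟨n₀, h⟩ := ih
    obtain ⟨ι, p, hc⟩ := exists_isMinimalCover_imageAt Q hproj hmin hQ i
    refine ⟨n₀ + 1, fun n hn => ?_⟩
    obtain ⟨n, rfl⟩ := Nat.exists_eq_add_of_le' (show 1 ≤ n by omega)
    exact hc.extVanishes_left (h _ (by omega))
  | pred i _ ih =>
    obtain ⟨n₀, h⟩ := ih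
    obtain ⟨i, rfl⟩ : ∃ j, i = j + 1 := ⟨i - 1, (sub_add_cancel i 1).symm⟩
    rw [add_sub_cancel_right]
    obtain ⟨ι, p, hc⟩ := exists_isMinimalCover_imageAt Q hproj hmin hQ i
    refine ⟨n₀ + 2, fun n hn => ?_⟩
    obtain ⟨n, rfl⟩ := Nat.exists_eq_add_of_le' (show 2 ≤ n by omega)
    exact hc.extVanishes_right (h _ (by omega))

end Complex

/-- In a minimal acyclic complex with a semi-Gorenstein-projective image `N_m`, the ranks in the
degrees `m`, `m + 1`, `m + 2` agree by `ranks_eq`, and `rank_recursion` propagates this in both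
directions. -/
theorem exists_rank_of_minimal_complex (k : Type v) [CommRing k] [IsArtinianRing k]
    {A : Type u} [Ring A] [Algebra k A] [Module.Finite k A] [IsLocalRing A] {e a : ℕ}
    (hA : HasShortType A e a) (hinj : ¬ Module.Injective A A)
    (Q : ChainComplex (ModuleCat.{u} A) ℤ) (hproj : IsProjectiveComplex Q)
    (hmin : IsMinimalComplex Q) (hQ : Q.Acyclic) {m : ℤ}
    (hm : IsSemiGorensteinProjective A (imageAt Q m)) :
    ∃ t : ℕ, (∀ i : ℤ, Nonempty (Q.X i ≃ₗ[A] (Fin t → A))) ∧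
      ∀ j : ℤ, HasDimVector A (imageAt Q j) t (a * t) := by
  have : IsArtinianRing A := IsArtinianRing.of_finite k A
  have hcover := exists_isMinimalCover_imageAt Q hproj hmin hQ
  have hExt := eventually_extVanishes_imageAt Q hproj hmin hQ hm
  have hrange : ∀ i, LinearMap.range (imageAt Q i).subtype ≤
      Ring.jacobson A • (⊤ : Submodule A (Q.X (i - 1))) := fun i => by
    rw [Submodule.range_subtype, ← module_jacobson_eq]
    exact hmin i
  have hsq : ∀ i, Ring.jacobson A ^ 2 • (⊤ : Submodule A (imageAt Q i)) = ⊥ := fun i =>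
    hA.sq_smul_eq_bot (Submodule.injective_subtype _) (hrange i)
  obtain ⟨t, ht⟩ : ∃ t : ℤ → ℕ, ∀ i, t i = topLen A (Q.X i) := ⟨_, fun _ => rfl⟩
  have htop : ∀ i, topLen A (imageAt Q i) = t i := fun i => by
    obtain ⟨ι, p, h⟩ := hcover i
    rw [ht, h.topLen_right hA]
  have hrec : ∀ i, t (i + 1 + 1) + a * t i = e * t (i + 1) := fun i => by
    obtain ⟨ι₀, p₀, h₀⟩ := hcover i
    obtain ⟨ι₁, p₁, h₁⟩ := hcover (i + 1)
    obtain ⟨n₁, hn₁⟩ := hExt (i + 1)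
    obtain ⟨n₂, hn₂⟩ := hExt (i + 1 + 1)
    have := rank_recursion (n₀ := max n₁ n₂) hA hinj h₀ h₁ (hsq i)
      (fun n hn => hn₁ n (le_trans (le_max_left _ _) hn))
      (fun n hn => hn₂ n (le_trans (le_max_right _ _) hn))
    rwa [htop, ← ht, ← ht] at this
  have hstart : t (m + 1) = t m ∧ e * t m = (1 + a) * t m := by
    obtain ⟨ι₀, p₀, h₀⟩ := hcover m
    obtain ⟨ι₁, p₁, h₁⟩ := hcover (m + 1)
    obtain ⟨ι₂, p₂, h₂⟩ := hcover (m + 1 + 1)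
    have := ranks_eq k hA hinj (Submodule.injective_subtype _) (hrange m) h₀ h₁ h₂ hm
    rw [← ht, ← ht] at this
    exact ⟨this.1, this.2.2.1⟩
  have hconst : ∀ i, t i = t m ∧ t (i + 1) = t m := by
    intro i
    induction i using Int.inductionOn' (b := m) with
    | zero => exact ⟨rfl, hstart.1⟩
    | succ i _ ih =>
      refine ⟨ih.2, ?_⟩
      have := hrec i
      rw [ih.1, ih.2, hstart.2] at this
      linarith
    | pred i _ ih =>
      rw [sub_add_cancel]
      refine ⟨?_, ih.1⟩
      -- the recursion can be solved for the lower rank only if `a ≠ 0`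
      rcases Nat.eq_zero_or_pos a with rfl | ha
      · have hzero : ∀ i, t i = 0 := fun i => by
          obtain ⟨n₀, hn₀⟩ := hExt i
          obtain ⟨ι, p, h⟩ := hcover i
          have := h.finite_right
          have := h.finite_free
          rw [← htop, topLen_eq_zero_iff]
          exact subsingleton_of_len_sq_eq_zero hA hinj (Submodule.injective_subtype _)
            (hrange i) hn₀
        rw [hzero, hzero]
      · have := hrec (i - 1)
        rw [sub_add_cancel, ih.1, ih.2, hstart.2] at this
        exact Nat.eq_of_mul_eq_mul_left ha (by linarith)
  refine ⟨t m, fun i => ?_, fun j => ⟨hsq j, ?_, ?_⟩⟩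
  · rw [← (hconst i).1, ht]
    have := (hproj i).1
    have := (hproj i).2
    exact exists_equiv_free_of_projective _
  · obtain ⟨ι, p, h⟩ := hcover j
    have := h.finite_free
    have := h.finite_right
    rw [← (hconst j).1, ← htop, topLen, cast_len]
  · obtain ⟨j, rfl⟩ : ∃ i, j = i + 1 := ⟨j - 1, (sub_add_cancel j 1).symm⟩
    obtain ⟨ι, p, h⟩ := hcover j
    obtain ⟨n₀, hn₀⟩ := hExt (j + 1)
    have := h.finite_left
    have h1 := h.radLen_left hA hinj (hsq _) hn₀
    rw [← ht, (hconst _).1] at h1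
    rw [← h1, radLen, cast_len]

/-! ### Duals as right modules -/

section DualMap

variable {A : Type u} [Ring A]
  {X Y Z : Type u} [AddCommGroup X] [Module A X] [AddCommGroup Y] [Module A Y]
  [AddCommGroup Z] [Module A Z]

/-- The transpose of a linear map, as a homomorphism of right modules. -/
def dualMap (f : X →ₗ[A] Y) : ADual A Y →ₗ[Aᵐᵒᵖ] ADual A X where
  toFun g := g ∘ₗ f
  map_add' _ _ := rfl
  map_smul' _ _ := rfl

theorem dualMap_comp (f : X →ₗ[A] Y) (g : Y →ₗ[A] Z) :
    dualMap (g ∘ₗ f) = dualMap f ∘ₗ dualMap g := rfl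

theorem dualMap_id : dualMap (LinearMap.id : X →ₗ[A] X) = LinearMap.id := rfl

theorem dualMap_injective {f : X →ₗ[A] Y} (hf : Function.Surjective f) :
    Function.Injective (dualMap f) := fun g g' h => LinearMap.ext fun y => by
  obtain ⟨x, rfl⟩ := hf y
  exact LinearMap.congr_fun h x

theorem dualMap_exact {f : X →ₗ[A] Y} {g : Y →ₗ[A] Z} (hg : Function.Surjective g)
    (hfg : Function.Exact f g) : Function.Exact (dualMap g) (dualMap f) := by
  intro φ
  constructor
  · exact exists_factor hg hfg φ
  · rintro ⟨ψ, rfl⟩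
    refine LinearMap.ext fun x => ?_
    change ψ (g (f x)) = 0
    rw [hfg.apply_apply_eq_zero, map_zero]

variable (A)

/-- The ring `A`, as a right module over itself, in its two encodings. -/
def opSelfEquiv : A ≃ₗ[Aᵐᵒᵖ] Aᵐᵒᵖ where
  toFun := MulOpposite.op
  invFun := MulOpposite.unop
  map_add' _ _ := rfl
  map_smul' _ _ := rfl
  left_inv _ := rfl
  right_inv _ := rfl

/-- The dual of a free left module is a free right module. -/
def dualFreeEquiv (t : ℕ) : ADual A (Fin t → A) ≃ₗ[Aᵐᵒᵖ] (Fin t → Aᵐᵒᵖ) where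
  toFun g i := MulOpposite.op (g (Pi.single i 1))
  invFun y := ∑ i, (LinearMap.toSpanSingleton A A (y i).unop) ∘ₗ LinearMap.proj i
  map_add' _ _ := rfl
  map_smul' _ _ := rfl
  left_inv g := by
    refine LinearMap.pi_ext' fun i => LinearMap.ext_ring ?_
    simp [Pi.single_apply]
  right_inv y := by
    funext i
    simp [LinearMap.sum_apply, Pi.single_apply]

variable {A}

theorem mem_smul_dual_free [IsLocalRing A] {t : ℕ} {g : ADual A (Fin t → A)}
    (hg : ∀ x, g x ∈ Ring.jacobson A) :
    g ∈ Ring.jacobson Aᵐᵒᵖ • (⊤ : Submodule Aᵐᵒᵖ (ADual A (Fin t → A))) := by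
  have h1 : dualFreeEquiv A t g ∈ Ring.jacobson Aᵐᵒᵖ • (⊤ : Submodule Aᵐᵒᵖ (Fin t → Aᵐᵒᵖ)) := by
    rw [smul_top_pi]
    exact fun i _ => op_mem_jacobson.mpr (hg _)
  have h2 := Submodule.mem_map_of_mem (f := (dualFreeEquiv A t).symm.toLinearMap) h1
  rw [Submodule.map_smul'', Submodule.map_top, LinearEquiv.range] at h2
  simpa using h2

end DualMap

section DualFinite

theorem finite_dual (k : Type v) [CommRing k] [IsArtinianRing k] (A : Type u) [Ring A]
    [Algebra k A] [Module.Finite k A] (M : Type u) [AddCommGroup M] [Module A M]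
    [Module.Finite A M] : Module.Finite Aᵐᵒᵖ (ADual A M) :=
  have := finite_hom k A M A
  Module.Finite.of_restrictScalars_finite k Aᵐᵒᵖ (ADual A M)

theorem finite_bidual (k : Type v) [CommRing k] [IsArtinianRing k] (A : Type u) [Ring A]
    [Algebra k A] [Module.Finite k A] (M : Type u) [AddCommGroup M] [Module A M]
    [Module.Finite A M] : Module.Finite A (ABidual A M) :=
  have := finite_dual k A M
  have : Module.Finite Aᵐᵒᵖ A := Module.Finite.equiv (opSelfEquiv A).symm
  have := finite_hom k Aᵐᵒᵖ (ADual A M) A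
  Module.Finite.of_restrictScalars_finite k A (ABidual A M)

variable (k : Type v) [CommRing k] [IsArtinianRing k]
  (A : Type u) [Ring A] [Algebra k A] [Module.Finite k A] [IsLocalRing A]
  (M : Type u) [AddCommGroup M] [Module A M] [Module.Finite A M]

/-- The length of `M^*` as a right module. -/
theorem len_base_dual : len k (M →ₗ[A] A) = resLen k A * len Aᵐᵒᵖ (ADual A M) := by
  have := finite_dual k A M
  rw [← resLen_op]
  exact len_base (k := k) (A := Aᵐᵒᵖ) (ADual A M)

/-- The length of `M^{**}`, with `A` as a right module replaced by `Aᵐᵒᵖ`. -/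
theorem len_base_bidual :
    len k (ADual A M →ₗ[Aᵐᵒᵖ] Aᵐᵒᵖ) = resLen k A * len A (ABidual A M) := by
  have := finite_bidual k A M
  rw [← len_base (k := k) (A := A) (ABidual A M)]
  exact (len_congr
    { toFun := fun f => (opSelfEquiv A).toLinearMap ∘ₗ f
      map_add' := fun _ _ => rfl
      map_smul' := fun _ _ => rfl
      invFun := fun g => (opSelfEquiv A).symm.toLinearMap ∘ₗ g
      left_inv := fun _ => rfl
      right_inv := fun _ => rfl }).symm

end DualFinite

/-! ### The length of the bidual -/

section Bidual

theorem len_bidual_of_injective (k : Type v) [CommRing k] [IsArtinianRing k]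
    {A : Type u} [Ring A] [Algebra k A] [Module.Finite k A] [IsLocalRing A]
    {M : Type u} [AddCommGroup M] [Module A M] [Module.Finite A M] (hinj : Module.Injective A A) :
    len A (ABidual A M) = len A M := by
  have := finite_dual k A M
  have h1 := len_base_bidual k A M
  rw [len_hom_eq_of_injective (injective_op k hinj), resLen_op] at h1
  have h2 := len_base_dual k A M
  rw [len_hom_eq_of_injective (k := k) hinj] at h2
  rw [← Nat.eq_of_mul_eq_mul_left resLen_pos h1, Nat.eq_of_mul_eq_mul_left resLen_pos h2]

/-- The dual of a minimal cover `0 → K → F → N → 0` is a minimal cover of `K^*` by right modules,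
if `Ext^1(N, A) = 0` and `N` has no free direct summand. -/
theorem IsMinimalCover.dual {A : Type u} [Ring A] [IsLocalRing A] {N K : Type u}
    [AddCommGroup N] [Module A N] [AddCommGroup K] [Module A K] {t : ℕ}
    {i : K →ₗ[A] (Fin t → A)} {p : (Fin t → A) →ₗ[A] N} (h : IsMinimalCover t i p)
    (hExt : ExtVanishes A N 1) (hN : ∀ f : N →ₗ[A] A, ¬ Function.Surjective f) :
    IsMinimalCover (A := Aᵐᵒᵖ) t (dualMap p) (dualMap i) where
  injective := dualMap_injective h.surjective
  surjective := h.exists_extension hExt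
  exact := dualMap_exact h.surjective h.exact
  free := ⟨dualFreeEquiv A t⟩
  range_le := by
    rintro _ ⟨f, rfl⟩
    refine mem_smul_dual_free fun x => ?_
    have hne : LinearMap.range f ≠ ⊤ := fun h => hN f (LinearMap.range_eq_top.mp h)
    exact le_jacobson_of_ne_top hne ⟨p x, rfl⟩

/-- The numerical part of `len_bidual_of_no_free_summand`. Here `t`, `t₁` are the first two ranks in
the minimal resolution of `M`, and `r` is the first rank in that of `M^*`; `m`, `x₁`, `x₂` are the
lengths of `M` and its first two syzygies, `x'` is the length of the dual of the first syzygy, `l`,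
`z` are those of `M^*` and its first syzygy, and `y` is that of `M^{**}`. -/
theorem bidual_arithmetic {e a t t₁ r x₁ x₂ x' z y m l : ℕ} (len₂ : x₂ = a * t₁ + t₁)
    (len₁ : x₂ + x₁ = t₁ * (1 + e + a)) (len₀ : x₁ + m = t * (1 + e + a))
    (e₁ : e * t₁ = (1 + a) * t₁) (d₁ : (1 + a) * t₁ + x' = t₁ * (1 + e + a))
    (lenL₁ : z = a * r + r) (lenL₀ : z + l = r * (1 + e + a)) (lenL : l = a * t + r)
    (e₄ : e * r = (1 + a) * r) (lend : l + x' = t * (1 + e + a))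
    (dL : (1 + a) * r + y = r * (1 + e + a)) (h : a = 0 → r = 0 ∧ t₁ = 0) : y = m := by
  rcases Nat.eq_zero_or_pos a with rfl | ha
  · obtain ⟨rfl, rfl⟩ := h rfl
    simp only [mul_zero, zero_mul, add_zero, zero_add] at *
    omega
  · have h1 : a * t = a * r := by linarith
    obtain rfl := Nat.eq_of_mul_eq_mul_left ha h1
    have h3 : (1 + a) * t₁ = (1 + a) * t := by linarith
    obtain rfl := Nat.eq_of_mul_eq_mul_left (by omega) h3
    linarith

/-- The case in which `M` has no free direct summand, so that the dual of the minimal cover of `M`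
is minimal again. -/
theorem len_bidual_of_no_free_summand (k : Type v) [CommRing k] [IsArtinianRing k]
    {A : Type u} [Ring A] [Algebra k A] [Module.Finite k A] [IsLocalRing A]
    {M : Type u} [AddCommGroup M] [Module A M] [Module.Finite A M] {e a : ℕ}
    (hA : HasShortType A e a) (hinj : ¬ Module.Injective A A)
    (hM : ∀ n, 1 ≤ n → ExtVanishes A M n)
    (hL : ∀ n, 1 ≤ n → ExtVanishes Aᵐᵒᵖ (ADual A M) n)
    (hfree : ∀ f : M →ₗ[A] A, ¬ Function.Surjective f) :
    len A (ABidual A M) = len A M := by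
  have : IsArtinianRing A := IsArtinianRing.of_finite k A
  have : IsArtinianRing Aᵐᵒᵖ := IsArtinianRing.of_finite k Aᵐᵒᵖ
  have hA' := hA.op k
  have hinj' : ¬ Module.Injective Aᵐᵒᵖ Aᵐᵒᵖ := fun h => hinj (injective_of_op k h)
  have := finite_dual k A M
  -- the left modules
  obtain ⟨p₀, h₀⟩ := exists_isMinimalCover (A := A) M
  obtain ⟨p₁, h₁⟩ := exists_isMinimalCover (A := A) (LinearMap.ker p₀)
  obtain ⟨p₂, h₂⟩ := exists_isMinimalCover (A := A) (LinearMap.ker p₁)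
  obtain ⟨p₃, h₃⟩ := exists_isMinimalCover (A := A) (LinearMap.ker p₂)
  have hM₁ := h₀.extVanishes_left_of_forall hM
  have hM₂ := h₁.extVanishes_left_of_forall hM₁
  have hM₁sq := hA.sq_smul_eq_bot h₀.injective h₀.range_le
  obtain ⟨e₂, -, e₁, d₂⟩ := ranks_eq k hA hinj h₀.injective h₀.range_le h₁ h₂ h₃ hM₁
  have rad₂ := h₁.radLen_left hA hinj hM₁sq hM₂
  have len₂ := len_eq_radLen_add_topLen (A := A) (X := LinearMap.ker p₁)
  have len₁ := h₁.len_add hA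
  have len₀ := h₀.len_add hA
  have d₁ := h₁.len_hom_add (k := k) hA (hM₁ 1 le_rfl)
  -- the right modules
  have hd := h₀.dual (hM 1 le_rfl) hfree
  obtain ⟨q₀, g₀⟩ := exists_isMinimalCover (A := Aᵐᵒᵖ) (ADual A M)
  obtain ⟨q₁, g₁⟩ := exists_isMinimalCover (A := Aᵐᵒᵖ) (LinearMap.ker q₀)
  obtain ⟨q₂, g₂⟩ := exists_isMinimalCover (A := Aᵐᵒᵖ) (LinearMap.ker q₁)
  have hL₁ := g₀.extVanishes_left_of_forall hL
  have hLsq := hA'.sq_smul_eq_bot hd.injective hd.range_le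
  obtain ⟨e₃, -, e₄, d₃⟩ := ranks_eq k hA' hinj' hd.injective hd.range_le g₀ g₁ g₂ hL
  have radL₁ := g₀.radLen_left hA' hinj' hLsq hL₁
  have lenL₁ := len_eq_radLen_add_topLen (A := Aᵐᵒᵖ) (X := LinearMap.ker q₀)
  have lenL₀ := g₀.len_add hA'
  have lenL := len_eq_radLen_add_topLen (A := Aᵐᵒᵖ) (X := ADual A M)
  have dL := g₀.len_hom_add (k := k) hA' (hL 1 le_rfl)
  -- comparison of the two sides in `0 → M^* → F₀^* → M₁^* → 0`
  have hM₁dual : Ring.jacobson Aᵐᵒᵖ ^ 2 •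
      (⊤ : Submodule Aᵐᵒᵖ (ADual A (LinearMap.ker p₀))) = ⊥ := by
    rw [← le_bot_iff]
    refine Submodule.smul_le.mpr fun r hr f _ => ?_
    obtain ⟨ψ, rfl⟩ := h₀.exists_extension (hM 1 le_rfl) f
    refine (Submodule.mem_bot _).mpr (LinearMap.ext fun x => ?_)
    have hx := Submodule.mem_map_of_mem (f := ψ) (h₀.range_le ⟨x, rfl⟩)
    rw [Submodule.map_smul'', Submodule.map_top] at hx
    have hx' : ψ x.1 ∈ Ring.jacobson A :=
      Submodule.smul_le.mpr (fun r hr y _ => Ideal.mul_mem_right y _ hr) hx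
    exact hA.jacobson_mul hx' (unop_mem_jacobson_pow hr)
  have radL := hd.radLen_left hA' hinj' hM₁dual hL
  have lend := hd.len_add hA'
  have base₁ := len_base_dual k A (LinearMap.ker p₀)
  have baseL := len_base_bidual k A M
  -- all lengths, in units of `resLen k A`
  rw [d₂, base₁, ← mul_add] at d₁
  have d₁' := Nat.eq_of_mul_eq_mul_left resLen_pos d₁
  rw [d₃, baseL, resLen_op, ← mul_add] at dL
  have dL' := Nat.eq_of_mul_eq_mul_left resLen_pos dL
  rw [e₂, rad₂] at len₂
  rw [e₃, radL₁] at lenL₁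
  rw [radL] at lenL
  refine bidual_arithmetic len₂ len₁ len₀ e₁ d₁' lenL₁ lenL₀ lenL e₄ lend dL' ?_
  rintro rfl
  have := h₁.finite_right
  exact ⟨topLen_eq_zero_iff.mpr
      (subsingleton_of_len_sq_eq_zero hA' hinj' hd.injective hd.range_le hL),
    topLen_eq_zero_iff.mpr
      (subsingleton_of_len_sq_eq_zero hA hinj h₀.injective h₀.range_le hM₁)⟩

/-- If `M` and `M^*` are semi-Gorenstein-projective, then `|M^{**}| = |M|`. Free direct summands of
`M` are split off by induction on `|M|`. -/
theorem len_bidual (k : Type v) [CommRing k] [IsArtinianRing k]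
    {A : Type u} [Ring A] [Algebra k A] [Module.Finite k A] [IsLocalRing A] {e a : ℕ}
    (hA : HasShortType A e a) (M : Type u) [AddCommGroup M] [Module A M] [Module.Finite A M]
    (hM : ∀ n, 1 ≤ n → ExtVanishes A M n)
    (hL : ∀ n, 1 ≤ n → ExtVanishes Aᵐᵒᵖ (ADual A M) n) :
    len A (ABidual A M) = len A M := by
  have : IsArtinianRing A := IsArtinianRing.of_finite k A
  by_cases hinj : Module.Injective A A
  · exact len_bidual_of_injective k hinj
  obtain ⟨l, hl⟩ : ∃ l, len A M = l := ⟨_, rfl⟩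
  induction l using Nat.strong_induction_on generalizing M with
  | _ l ih =>
  by_cases hfree : ∀ f : M →ₗ[A] A, ¬ Function.Surjective f
  · exact len_bidual_of_no_free_summand k hA hinj hM hL hfree
  push Not at hfree
  obtain ⟨f, hf⟩ := hfree
  obtain ⟨s, hs⟩ := Module.projective_lifting_property f LinearMap.id hf
  have hfs : ∀ x, f (s x) = x := LinearMap.congr_fun hs
  let K := LinearMap.ker f
  let π : M →ₗ[A] K := (LinearMap.id - s ∘ₗ f).codRestrict K fun x => by
    change f (x - s (f x)) = 0
    rw [map_sub, hfs, sub_self]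
  have hπ : π ∘ₗ K.subtype = LinearMap.id := LinearMap.ext fun x => Subtype.ext (by
    change x.1 - s (f x.1) = x.1
    rw [LinearMap.mem_ker.mp x.2, map_zero, sub_zero])
  have hlenM := len_add_of_exact K.injective_subtype hf f.exact_subtype_ker_map
  have hpos : len A A ≠ 0 := by
    rw [Ne, len_eq_zero_iff]
    exact not_subsingleton A
  have hK := ih (len A K) (by omega) K (fun n hn => (hM n hn).of_retract K.subtype π hπ)
    (fun n hn => (hL n hn).of_retract (dualMap π) (dualMap K.subtype)
      (by rw [← dualMap_comp, hπ, dualMap_id])) rfl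
  have := finite_dual k A M
  have hsurj : Function.Surjective (dualMap K.subtype) := fun g =>
    ⟨dualMap π g, by rw [← LinearMap.comp_apply, ← dualMap_comp, hπ, dualMap_id]; rfl⟩
  have h1 := len_hom_eq_of_exact (k := k) hsurj (dualMap_exact hf f.exact_subtype_ker_map)
    fun φ => ⟨φ ∘ₗ dualMap s, by rw [LinearMap.comp_assoc, ← dualMap_comp, hs, dualMap_id]; rfl⟩
  have h2 : len k (ADual A A →ₗ[Aᵐᵒᵖ] Aᵐᵒᵖ) = resLen k A * len A A := by
    let E : Aᵐᵒᵖ ≃ₗ[Aᵐᵒᵖ] ADual A A :=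
      { toFun := fun x => LinearMap.toSpanSingleton A A x.unop
        invFun := fun g => MulOpposite.op (g 1)
        map_add' := fun x y => LinearMap.ext_ring (by simp)
        map_smul' := fun c x => LinearMap.ext_ring (by simp)
        left_inv := fun x => by simp
        right_inv := fun g => LinearMap.ext_ring (by simp) }
    rw [← len_congr (LinearEquiv.congrLeft Aᵐᵒᵖ k E), len_hom_self,
      ← len_congr (MulOpposite.opLinearEquiv k (M := A)), len_base (k := k) (A := A) A]
  rw [h2, len_base_bidual, len_base_bidual, hK, ← mul_add] at h1
  rw [hlenM, Nat.eq_of_mul_eq_mul_left resLen_pos h1, add_comm]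

end Bidual

/-! ### Free resolutions -/

section Resolution

variable {B : Type u} [Ring B]

theorem exists_free_resolution [IsNoetherianRing B] (M : Type u) [AddCommGroup M] [Module B M]
    [Module.Finite B M] :
    ∃ (n : ℕ → ℕ) (d : ∀ i, (Fin (n (i + 1)) → B) →ₗ[B] (Fin (n i) → B))
      (p : (Fin (n 0) → B) →ₗ[B] M), Function.Surjective p ∧ Function.Exact (d 0) p ∧
        ∀ i, Function.Exact (d (i + 1)) (d i) := by
  obtain ⟨n₀, p, hp⟩ := Module.Finite.exists_fin' B M
  have hstep : ∀ s : Σ n, Submodule B (Fin n → B),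
      ∃ (m : ℕ) (q : (Fin m → B) →ₗ[B] s.2), Function.Surjective q := fun s =>
    Module.Finite.exists_fin' B s.2
  choose m q hq using hstep
  -- a state of the recursion is a rank `n` together with the kernel in `B ^ n` still to be covered
  let f : ℕ → Σ n, Submodule B (Fin n → B) := fun i =>
    Nat.rec ⟨n₀, LinearMap.ker p⟩ (fun _ s => ⟨m s, LinearMap.ker (q s)⟩) i
  refine ⟨fun i => (f i).1, fun i => (f i).2.subtype ∘ₗ q (f i), p, hp, ?_, fun i => ?_⟩
  · rw [LinearMap.exact_iff, LinearMap.range_comp_of_range_eq_top _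
      (LinearMap.range_eq_top.mpr (hq (f 0))), Submodule.range_subtype]
    rfl
  · rw [LinearMap.exact_iff, LinearMap.range_comp_of_range_eq_top _
      (LinearMap.range_eq_top.mpr (hq (f (i + 1)))), Submodule.range_subtype,
      LinearMap.ker_comp, Submodule.ker_subtype, Submodule.comap_bot]

variable {M : Type u} [AddCommGroup M] [Module B M] {n : ℕ → ℕ}
  {d : ∀ i, (Fin (n (i + 1)) → B) →ₗ[B] (Fin (n i) → B)} {p : (Fin (n 0) → B) →ₗ[B] M}
  (hp : Function.Surjective p) (h0 : Function.Exact (d 0) p)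
  (hd : ∀ i, Function.Exact (d (i + 1)) (d i)) (hM : ∀ i, 1 ≤ i → ExtVanishes B M i)
include hp h0 hd hM

/-- The module for index `i` is the cokernel of `d i`: this is `M` for `i = 0`, and in general the
`i`-th syzygy of `M`. -/
theorem extVanishes_syzygy (i j : ℕ) (hj : 1 ≤ j) :
    ExtVanishes B ((Fin (n i) → B) ⧸ LinearMap.range (d i)) j := by
  induction i generalizing j with
  | zero =>
    refine (hM j hj).of_equiv (Submodule.quotEquivOfEq _ _ h0.linearMap_ker_eq.symm ≪≫ₗ
      p.quotKerEquivOfSurjective hp)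
  | succ i ih =>
    obtain ⟨j, rfl⟩ := Nat.exists_eq_add_of_le' hj
    have h1 : ExtVanishes B (LinearMap.range (d i)) (j + 1) :=
      (extVanishes_of_projective j).left (LinearMap.range (d i)).injective_subtype
        (LinearMap.range (d i)).mkQ_surjective (LinearMap.exact_subtype_mkQ _) (ih _ (by omega))
    exact h1.of_equiv (Submodule.quotEquivOfEq _ _ (hd i).linearMap_ker_eq.symm ≪≫ₗ
      (d i).quotKerEquivRange)

/-- The dual of a free resolution of a semi-Gorenstein-projective module is exact. -/
theorem exists_lift_of_comp_eq_zero (i : ℕ) (φ : (Fin (n (i + 1)) → B) →ₗ[B] B)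
    (hφ : φ ∘ₗ d (i + 1) = 0) : ∃ ψ : (Fin (n i) → B) →ₗ[B] B, ψ ∘ₗ d i = φ := by
  have hex : Function.Exact (d (i + 1)) (d i).rangeRestrict := by
    rw [LinearMap.exact_iff, LinearMap.ker_rangeRestrict]
    exact (hd i).linearMap_ker_eq
  obtain ⟨χ, hχ⟩ := exists_factor (LinearMap.surjective_rangeRestrict _) hex φ hφ
  obtain ⟨ψ, hψ⟩ := (extVanishes_syzygy hp h0 hd hM i 1 le_rfl).exists_extension
    (LinearMap.range (d i)).injective_subtype (LinearMap.range (d i)).mkQ_surjective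
    (LinearMap.exact_subtype_mkQ _) χ
  refine ⟨ψ, ?_⟩
  rw [← hχ, ← hψ]
  rfl

end Resolution

/-! ### Gluing two complexes -/

section Glue

variable {A : Type u} [Ring A]

/-- `X → Y → Z` is exact, and so is its dual. -/
def IsBiexact {X Y Z : Type u} [AddCommGroup X] [Module A X] [AddCommGroup Y] [Module A Y]
    [AddCommGroup Z] [Module A Z] (f : X →ₗ[A] Y) (g : Y →ₗ[A] Z) : Prop :=
  Function.Exact f g ∧ Function.Exact (fun h : Z →ₗ[A] A => h ∘ₗ g) (fun h : Y →ₗ[A] A => h ∘ₗ f)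

/-- The terms of `⋯ → P₁ → P₀ → R₀ → R₁ → ⋯`, with `P₀` in degree `0`. -/
def gluedObj (P R : ℕ → ModuleCat.{u} A) : ℤ → ModuleCat.{u} A
  | .ofNat i => P i
  | .negSucc i => R i

variable {P R : ℕ → ModuleCat.{u} A} (dP : ∀ i, P (i + 1) ⟶ P i) (g : P 0 ⟶ R 0)
  (dR : ∀ i, R i ⟶ R (i + 1))

/-- The differentials of `⋯ → P₁ → P₀ → R₀ → R₁ → ⋯`. -/
def gluedD : ∀ i : ℤ, gluedObj P R (i + 1) ⟶ gluedObj P R i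
  | .ofNat i => dP i
  | .negSucc 0 => g
  | .negSucc (i + 1) => dR i

/-- `M ≅ Im (P₀ → R₀)` is Gorenstein-projective if `⋯ → P₁ → P₀ → R₀ → R₁ → ⋯` is a complete
projective resolution. -/
theorem isGorensteinProjective_of_glue
    (hP : ∀ i, Module.Finite A (P i) ∧ Module.Projective A (P i))
    (hR : ∀ i, Module.Finite A (R i) ∧ Module.Projective A (R i))
    (hPP : ∀ i, IsBiexact (dP (i + 1)).hom (dP i).hom)
    (hPg : IsBiexact (dP 0).hom g.hom) (hgR : IsBiexact g.hom (dR 0).hom)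
    (hRR : ∀ i, IsBiexact (dR i).hom (dR (i + 1)).hom)
    {M : Type u} [AddCommGroup M] [Module A M] (e : M ≃ₗ[A] LinearMap.range g.hom) :
    IsGorensteinProjective A M := by
  have hD : ∀ j : ℤ, IsBiexact (gluedD dP g dR (j + 1)).hom (gluedD dP g dR j).hom
    | .ofNat i => hPP i
    | .negSucc 0 => hPg
    | .negSucc 1 => hgR
    | .negSucc (i + 2) => hRR i
  have hsq : ∀ j : ℤ, gluedD dP g dR (j + 1) ≫ gluedD dP g dR j = 0 := fun j =>
    ModuleCat.hom_ext (hD j).1.linearMap_comp_eq_zero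
  let C : ChainComplex (ModuleCat.{u} A) ℤ := ChainComplex.of _ (gluedD dP g dR) hsq
  have hC : ∀ j : ℤ, C.d (j + 1) j = gluedD dP g dR j := fun j =>
    ChainComplex.of_d _ _ j
  have hdual : ∀ j l : ℤ, l = j → Function.Exact
      (fun h : C.X l →ₗ[A] A => h ∘ₗ (C.d (j + 1) l).hom)
      (fun h : C.X (j + 1) →ₗ[A] A => h ∘ₗ (C.d (j + 1 + 1) (j + 1)).hom) := by
    rintro j _ rfl
    rw [hC, hC]
    exact (hD _).2
  have himage : ∀ j l : ℤ, l = j + 1 →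
      Nonempty (LinearMap.range (gluedD dP g dR j).hom ≃ₗ[A] LinearMap.range (C.d l j).hom) := by
    rintro j _ rfl
    rw [hC]
    exact ⟨LinearEquiv.refl _ _⟩
  obtain ⟨e'⟩ := himage (.negSucc 0) 0 rfl
  refine ⟨C, ?_, ?_, ?_, ⟨e.trans e'⟩⟩
  · rintro (i | i)
    · exact hP i
    · exact hR i
  · intro i
    obtain ⟨j, rfl⟩ : ∃ j, i = j + 1 := ⟨i - 1, (sub_add_cancel i 1).symm⟩
    rw [C.exactAt_iff' (j + 1 + 1) (j + 1) j (ComplexShape.prev_eq' _ rfl)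
      (ComplexShape.next_eq' _ rfl), ShortComplex.ShortExact.moduleCat_exact_iff_function_exact]
    change Function.Exact (C.d (j + 1 + 1) (j + 1)).hom (C.d (j + 1) j).hom
    rw [hC, hC]
    exact (hD j).1
  · intro i
    obtain ⟨j, rfl⟩ : ∃ j, i = j + 1 := ⟨i - 1, (sub_add_cancel i 1).symm⟩
    exact hdual j _ (add_sub_cancel_right j 1)

end Glue

/-! ### Reflexive modules with semi-Gorenstein-projective dual -/

section Reflexive

variable (A : Type u) [Ring A]

/-- The left module `Hom (A ^ r, A)` of homomorphisms of right modules. -/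
abbrev RightDual (r : ℕ) : Type u := (Fin r → Aᵐᵒᵖ) →ₗ[Aᵐᵒᵖ] A

/-- The dual of a free right module is a free left module. -/
def rightDualEquiv (r : ℕ) : RightDual A r ≃ₗ[A] (Fin r → A) where
  toFun g i := g (Pi.single i 1)
  invFun y := ∑ i, (LinearMap.toSpanSingleton Aᵐᵒᵖ A (y i)) ∘ₗ LinearMap.proj i
  map_add' _ _ := rfl
  map_smul' _ _ := rfl
  left_inv g := by
    refine LinearMap.pi_ext' fun i => LinearMap.ext_ring ?_
    simp [Pi.single_apply]
  right_inv y := by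
    funext i
    simp [Pi.single_apply]

variable {A}

/-- Precomposition with a homomorphism of free right modules. -/
def rightTranspose {r s : ℕ} (δ : (Fin s → Aᵐᵒᵖ) →ₗ[Aᵐᵒᵖ] (Fin r → Aᵐᵒᵖ)) :
    RightDual A r →ₗ[A] RightDual A s where
  toFun g := g ∘ₗ δ
  map_add' _ _ := rfl
  map_smul' _ _ := rfl

/-- Evaluation at an element of a free right module. -/
def rightEval {r : ℕ} (x : Fin r → Aᵐᵒᵖ) : RightDual A r →ₗ[A] A where
  toFun g := g x
  map_add' _ _ := rfl
  map_smul' _ _ := rfl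

/-- Free right modules are reflexive. -/
theorem exists_eq_rightEval {r : ℕ} (h : RightDual A r →ₗ[A] A) : ∃ x, rightEval x = h := by
  let c : Fin r → RightDual A r := fun i => (rightDualEquiv A r).symm (Pi.single i 1)
  refine ⟨fun i => MulOpposite.op (h (c i)), LinearMap.ext fun g => ?_⟩
  have h1 : g = ∑ i, g (Pi.single i 1) • c i := by
    apply (rightDualEquiv A r).injective
    rw [map_sum]
    simp only [map_smul, c, LinearEquiv.apply_symm_apply]
    exact pi_eq_sum_univ' _
  have h2 : (fun i => MulOpposite.op (h (c i))) =
      ∑ i, MulOpposite.op (h (c i)) • (Pi.single i 1 : Fin r → Aᵐᵒᵖ) := pi_eq_sum_univ' _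
  have h3 : h g = ∑ i, g (Pi.single i 1) * h (c i) := by
    conv_lhs => rw [h1]
    simp only [map_sum, map_smul, smul_eq_mul]
  rw [h3]
  change g _ = _
  rw [h2, map_sum]
  simp only [map_smul]
  rfl

theorem eq_zero_of_forall_rightDual {r : ℕ} {x : Fin r → Aᵐᵒᵖ}
    (hx : ∀ g : RightDual A r, g x = 0) : x = 0 := funext fun i =>
  (opSelfEquiv A).symm.map_eq_zero_iff.mp
    (hx ((opSelfEquiv A).symm.toLinearMap ∘ₗ LinearMap.proj i))

/-- A reflexive module `M` such that `M` and `M^*` are semi-Gorenstein-projective is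
Gorenstein-projective: a free resolution of `M` and the dual of a free resolution of `M^*` are
glued along `M → M^{**}`. -/
theorem isGorensteinProjective_of_bijective [IsNoetherianRing A] [IsNoetherianRing Aᵐᵒᵖ]
    (M : Type u) [AddCommGroup M] [Module A M] [Module.Finite A M]
    [Module.Finite Aᵐᵒᵖ (ADual A M)] (hM : ∀ n, 1 ≤ n → ExtVanishes A M n)
    (hL : ∀ n, 1 ≤ n → ExtVanishes Aᵐᵒᵖ (ADual A M) n) (hφ : Function.Bijective (phi A M)) :
    IsGorensteinProjective A M := by
  obtain ⟨n, d, p, hp, h0, hd⟩ := exists_free_resolution (B := A) M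
  obtain ⟨r, δ, ρ, hρ, k0, hδ⟩ := exists_free_resolution (B := Aᵐᵒᵖ) (ADual A M)
  let ι : M →ₗ[A] RightDual A (r 0) :=
    { toFun := fun m => phi A M m ∘ₗ ρ
      map_add' := fun _ _ => by rw [map_add]; rfl
      map_smul' := fun _ _ => by rw [map_smul]; rfl }
  have hι : Function.Injective ι := fun m m' h => hφ.1 (LinearMap.ext fun f => by
    obtain ⟨x, rfl⟩ := hρ f
    exact LinearMap.congr_fun h x)
  refine isGorensteinProjective_of_glue (P := fun i => ModuleCat.of A (Fin (n i) → A))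
    (R := fun i => ModuleCat.of A (RightDual A (r i))) (fun i => ModuleCat.ofHom (d i))
    (ModuleCat.ofHom (ι ∘ₗ p)) (fun i => ModuleCat.ofHom (rightTranspose (δ i)))
    (fun i => ⟨?_, ?_⟩) (fun i => ⟨?_, ?_⟩) (fun i => ⟨hd i, ?_⟩) ⟨?_, ?_⟩ ⟨?_, ?_⟩
    (fun i => ⟨?_, ?_⟩) ?_
  · exact inferInstanceAs (Module.Finite A (Fin (n i) → A))
  · exact inferInstanceAs (Module.Projective A (Fin (n i) → A))
  · exact Module.Finite.equiv (rightDualEquiv A (r i)).symm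
  · exact Module.Projective.of_equiv (rightDualEquiv A (r i)).symm
  · -- the resolution of `M`, dualized
    intro φ
    constructor
    · exact exists_lift_of_comp_eq_zero hp h0 hd hM i φ
    · rintro ⟨ψ, rfl⟩
      change (ψ ∘ₗ d i) ∘ₗ d (i + 1) = 0
      rw [LinearMap.comp_assoc, (hd i).linearMap_comp_eq_zero, LinearMap.comp_zero]
  · -- exactness at `P₀`
    intro y
    change ι (p y) = 0 ↔ y ∈ Set.range (d 0)
    rw [← h0 y, map_eq_zero_iff ι hι]
  · intro φ
    constructor
    · intro h
      obtain ⟨ψ, rfl⟩ := exists_factor hp h0 φ h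
      obtain ⟨x, rfl⟩ := hρ ψ
      exact ⟨rightEval x, LinearMap.ext fun y => rfl⟩
    · rintro ⟨ψ, rfl⟩
      change (ψ ∘ₗ ι ∘ₗ p) ∘ₗ d 0 = 0
      rw [LinearMap.comp_assoc, LinearMap.comp_assoc, h0.linearMap_comp_eq_zero,
        LinearMap.comp_zero, LinearMap.comp_zero]
  · -- exactness at the dual of `R₀`
    intro g
    constructor
    · intro h
      obtain ⟨ψ, hψ⟩ := exists_factor hρ k0 g h
      obtain ⟨m, rfl⟩ := hφ.2 ψ
      obtain ⟨y, rfl⟩ := hp m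
      exact ⟨y, hψ⟩
    · rintro ⟨y, rfl⟩
      refine LinearMap.ext fun x => ?_
      change ρ (δ 0 x) (p y) = 0
      rw [k0.apply_apply_eq_zero]
      rfl
  · intro h
    constructor
    · intro hh
      obtain ⟨x, rfl⟩ := exists_eq_rightEval h
      have hx : ρ x = 0 := LinearMap.ext fun m => by
        obtain ⟨y, rfl⟩ := hp m
        exact LinearMap.congr_fun hh y
      obtain ⟨x', rfl⟩ := (k0 x).mp hx
      exact ⟨rightEval x', LinearMap.ext fun g => rfl⟩
    · rintro ⟨ψ, rfl⟩
      obtain ⟨x, rfl⟩ := exists_eq_rightEval ψ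
      refine LinearMap.ext fun y => ?_
      change ρ (δ 0 x) (p y) = 0
      rw [k0.apply_apply_eq_zero]
      rfl
  · -- the resolution of `M^*`, dualized
    intro g
    constructor
    · intro h
      obtain ⟨ψ, hψ⟩ := exists_lift_of_comp_eq_zero hρ k0 hδ hL i
        ((opSelfEquiv A).toLinearMap ∘ₗ g) (LinearMap.ext fun x =>
          congrArg (opSelfEquiv A) (LinearMap.congr_fun h x))
      refine ⟨(opSelfEquiv A).symm.toLinearMap ∘ₗ ψ, LinearMap.ext fun x => ?_⟩
      exact congrArg (opSelfEquiv A).symm (LinearMap.congr_fun hψ x)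
    · rintro ⟨ψ, rfl⟩
      refine LinearMap.ext fun x => ?_
      change ψ (δ i (δ (i + 1) x)) = 0
      rw [(hδ i).apply_apply_eq_zero, map_zero]
  · intro h
    constructor
    · intro hh
      obtain ⟨x, rfl⟩ := exists_eq_rightEval h
      have hx : δ i x = 0 := eq_zero_of_forall_rightDual fun g => LinearMap.congr_fun hh g
      obtain ⟨x', rfl⟩ := (hδ i x).mp hx
      exact ⟨rightEval x', LinearMap.ext fun g => rfl⟩
    · rintro ⟨ψ, rfl⟩
      obtain ⟨x, rfl⟩ := exists_eq_rightEval ψ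
      refine LinearMap.ext fun g => ?_
      change g (δ i (δ (i + 1) x)) = 0
      rw [(hδ i).apply_apply_eq_zero, map_zero]
  · have hrange : LinearMap.range (ι ∘ₗ p) = LinearMap.range ι :=
      LinearMap.range_comp_of_range_eq_top _ (LinearMap.range_eq_top.mpr hp)
    exact (LinearEquiv.ofInjective ι hι).trans (LinearEquiv.ofEq _ _ hrange.symm)

end Reflexive

end ShortLocal

open ShortLocal in
theorem proposition4p2 {k : Type v} [CommRing k] [IsArtinianRing k]
    {A : Type u} [Ring A] [Algebra k A] [Module.Finite k A] [IsLocalRing A]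
    (hshort : IsShort A) (e a : ℕ) (htype : HasHilbertType A e a) :
    (¬ Module.Injective A A →
      ∀ Q : ChainComplex (ModuleCat.{u} A) ℤ,
        IsProjectiveComplex Q → IsMinimalComplex Q → Q.Acyclic →
        (∃ i : ℤ, IsSemiGorensteinProjective A (imageAt Q i)) →
        ∃ t : ℕ, (∀ i : ℤ, Nonempty (Q.X i ≃ₗ[A] (Fin t → A))) ∧
          ∀ j : ℤ, HasDimVector A (imageAt Q j) t (a * t)) ∧
    (∀ (M : Type u) [AddCommGroup M] [Module A M] [Module.Finite A M],
      IsSemiGorensteinProjective A M → IsSemiGorensteinProjective Aᵐᵒᵖ (ADual A M) →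
      Module.length A (LinearMap.ker (phi A M)) =
          Module.length A (ABidual A M ⧸ LinearMap.range (phi A M)) ∧
        (Function.Injective (phi A M) ∨ Function.Surjective (phi A M) →
          Function.Bijective (phi A M) ∧ IsGorensteinProjective A M)) := by
  have : IsArtinianRing A := IsArtinianRing.of_finite k A
  have : IsArtinianRing Aᵐᵒᵖ := IsArtinianRing.of_finite k Aᵐᵒᵖ
  have hA := hshort.hasShortType htype
  refine ⟨fun hinj Q hproj hmin hQ ⟨m, hm⟩ =>
    exists_rank_of_minimal_complex k hA hinj Q hproj hmin hQ hm, fun M _ _ _ hM hL => ?_⟩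
  have := finite_dual k A M
  have := finite_bidual k A M
  have hlen := len_bidual k hA M hM hL
  have h1 := len_range_add_ker (phi A M)
  have h2 := len_add_quotient (LinearMap.range (phi A M))
  have heq : len A (LinearMap.ker (phi A M)) =
      len A (ABidual A M ⧸ LinearMap.range (phi A M)) := by omega
  refine ⟨by rw [← cast_len, ← cast_len, heq], fun h => ?_⟩
  have hbij : Function.Bijective (phi A M) := by
    have hinj_iff : Function.Injective (phi A M) ↔ len A (LinearMap.ker (phi A M)) = 0 := by
      rw [len_eq_zero_iff, Submodule.subsingleton_iff_eq_bot, LinearMap.ker_eq_bot]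
    have hsurj_iff : Function.Surjective (phi A M) ↔
        len A (ABidual A M ⧸ LinearMap.range (phi A M)) = 0 := by
      rw [len_eq_zero_iff, Submodule.Quotient.subsingleton_iff, LinearMap.range_eq_top]
    rcases h with h | h
    · exact ⟨h, hsurj_iff.mpr (heq ▸ hinj_iff.mp h)⟩
    · exact ⟨hinj_iff.mpr (heq ▸ hsurj_iff.mp h), h⟩
  exact ⟨hbij, isGorensteinProjective_of_bijective M hM hL hbij⟩
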